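/- Fix a constant $\sigma>0$. Let $(n_k),(p_k),(s_k),(d_k)$ be sequences of natural numbers (we drop the index $k$) with $s\le p$, $d\le p$, such that, as $k\to\infty$, $p,s,d\to\infty$, $d=o(p)$ and $ds/p\to\infty$. **Model.** Let $X\in\mathbb R^{n\times p}$ have entries $X_{ij}=B_{ij}N_{ij}$ with $B_{ij}\sim\mathrm{Ber}(d/p)$ and $N_{ij}\sim\mathcal N(0,1)$, let $Z\sim\mathcal N(0,\sigma^2 I_n)$, all the variables $B_{ij},N_{ij},Z_i$ being mutually independent, and for $\beta^\star\in\mathbb R^p$ put $Y=X\beta^\star+Z$. Write $\operatorname{supp}(\beta)=\{i:\beta_i\neq0\}$ and $$\mathcal C_{p,s}=\{\beta\in\mathbb R^p: |\operatorname{supp}(\beta)|=s,\ |\beta_i|\ge1 \text{ for all } i\in\operatorname{supp}(\beta)\}.$$ For $\beta^\star\in\{0,1\}^p$ with $|\operatorname{supp}(\beta^\star)|=s$, a maximum likelihood estimator (MLE) $\hat\beta$ is any minimizer of $\|Y-X\beta\|_2^2$ over $\beta\in\{0,1\}^p$ with $|\operatorname{supp}(\beta)|=s$ (ties are broken arbitrarily).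 **Threshold.** Let 1. $n_{\rm INF}^{\rm SP}=\dfrac{2s\log(p/s)}{\log(ds/p)}$ if $s=o(p)$; 2. $n_{\rm INF}^{\rm SP}=\dfrac{2H(\alpha)p}{\log d}$ if $s/p\to\alpha$ for a constant $\alpha\in(0,1)$ (in particular if $s=\alpha p$), where $H(\alpha)=-\alpha\log\alpha-(1-\alpha)\log(1-\alpha)$. Then in each of these two regimes: (i) If there is $\varepsilon>0$ with $n\le(1-\varepsilon)\,n_{\rm INF}^{\rm SP}$ for all large $k$, then there is no sequence of decoders (measurable maps $g$ from pairs $(X,Y)\in\mathbb R^{n\times p}\times\mathbb R^n$ to subsets of $\{1,\dots,p\}$; in particular none that depend on $Y$ alone) such that $$\sup_{\beta^\star\in\mathcal C_{p,s}}\mathbb P_{X,Z}\big(g(X,Y)\neq\operatorname{supp}(\beta^\star)\big)\longrightarrow0 .$$ (ii) If there is $\varepsilon>0$ with $n\ge(1+\varepsilon)\,n_{\rm INF}^{\rm SP}$ for all large $k$, then for every sequence of signals $\beta^\star\in\{0,1\}^p$ with $|\operatorname{supp}(\beta^\star)|=s$ and every choice of MLE $\hat\beta$, $$\frac{|\operatorname{supp}(\hat\beta)\,\triangle\,\operatorname{supp}(\beta^\star)|}{2s}\longrightarrow0\quad\text{in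 probability.}$$ -/

import Mathlib

open MeasureTheory ProbabilityTheory Filter Topology Asymptotics

noncomputable section

namespace SparseRecovery

/-- The support of a vector: the set of indices of its non-zero components. -/
def supp {p : ℕ} (β : Fin p → ℝ) : Finset (Fin p) :=
  Finset.univ.filter fun i => β i ≠ 0

/-- Real signals with exactly `s` non-zero components, each of absolute value at least `1`. -/
def signalClass (p s : ℕ) : Set (Fin p → ℝ) :=
  {β | (supp β).card = s ∧ ∀ i ∈ supp β, 1 ≤ |β i|}

/-- Binary signals with exactly `s` non-zero components. -/
def binarySignals (p s : ℕ) : Set (Fin p → ℝ) :=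
  {β | (∀ i, β i = 0 ∨ β i = 1) ∧ (supp β).card = s}

/-- The density rate `d / p` as a point of the unit interval. -/
def densityRate (d p : ℕ) (h : d ≤ p) : unitInterval :=
  ⟨(d : ℝ) / p, by positivity, div_le_one_of_le₀ (by exact_mod_cast h) (by positivity)⟩

/-- The random variables behind the model: `B i j` are Bernoulli with mean `d / p`, `N i j` are
standard Gaussian, the noise components `Z i` are centred Gaussian of variance `σ ^ 2`, and all
of them together are mutually independent. -/
structure IsSparseGaussianModel {Ω : Type*} [MeasurableSpace Ω] (P : Measure Ω) {n p : ℕ}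
    (d : ℕ) (hdp : d ≤ p) (σ : ℝ) (B N : Fin n → Fin p → Ω → ℝ) (Z : Fin n → Ω → ℝ) : Prop where
  law_B : ∀ i j, HasLaw (B i j) (bernoulliMeasure 1 0 (densityRate d p hdp)) P
  law_N : ∀ i j, HasLaw (N i j) (gaussianReal 0 1) P
  law_Z : ∀ i, HasLaw (Z i) (gaussianReal 0 ⟨σ ^ 2, sq_nonneg σ⟩) P
  indep : iIndepFun
    (Sum.elim (fun ij : Fin n × Fin p => B ij.1 ij.2)
      (Sum.elim (fun ij : Fin n × Fin p => N ij.1 ij.2) Z)) P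

/-- The sparse Gaussian matrix with entries `B i j * N i j`. -/
def sparseMatrix {Ω : Type*} {n p : ℕ} (B N : Fin n → Fin p → Ω → ℝ) (ω : Ω) :
    Matrix (Fin n) (Fin p) ℝ :=
  Matrix.of fun i j => B i j ω * N i j ω

/-- The observation vector `Y = X β + Z`. -/
def observation {Ω : Type*} {n p : ℕ} (B N : Fin n → Fin p → Ω → ℝ) (Z : Fin n → Ω → ℝ)
    (β : Fin p → ℝ) (ω : Ω) : Fin n → ℝ :=
  (sparseMatrix B N ω).mulVec β + fun i => Z i ω

/-- A decoder: a measurable map from the measurement matrix and the observations to sets of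
indices. Decoders that only look at the observations are a special case. -/
structure Decoder (n p : ℕ) where
  toFun : (Fin n → Fin p → ℝ) → (Fin n → ℝ) → Finset (Fin p)
  measurable_toFun : Measurable (Function.uncurry toFun)

/-- The worst-case probability, over signals in `signalClass p s`, that the decoder misses the
exact support. -/
def worstCaseError {Ω : Type*} [MeasurableSpace Ω] (P : Measure Ω) {n p : ℕ} (s : ℕ)
    (B N : Fin n → Fin p → Ω → ℝ) (Z : Fin n → Ω → ℝ) (g : Decoder n p) : ENNReal :=
  ⨆ β ∈ signalClass p s,
    P {ω | g.toFun (sparseMatrix B N ω) (observation B N Z β ω) ≠ supp β}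

/-- `βhat` is a maximum likelihood estimate: it minimizes `‖Y - X β‖₂²` over binary signals with
`s` non-zero components. -/
def IsMLE {n p : ℕ} (s : ℕ) (X : Matrix (Fin n) (Fin p) ℝ) (Y : Fin n → ℝ)
    (βhat : Fin p → ℝ) : Prop :=
  βhat ∈ binarySignals p s ∧
    IsMinOn (fun β => ‖WithLp.toLp 2 (Y - X.mulVec β)‖ ^ 2) (binarySignals p s) βhat

/-- The normalized support error `|supp βhat ∆ supp β| / (2 s)`. -/
def supportError {p : ℕ} (s : ℕ) (βhat β : Fin p → ℝ) : ℝ :=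
  ((symmDiff (supp βhat) (supp β)).card : ℝ) / (2 * s)

/-- The threshold when `s = o(p)`. -/
def thresholdSublinear (p s d : ℕ) : ℝ :=
  2 * s * Real.log (p / s) / Real.log (d * s / p)

/-- The threshold when `s` is proportional to `p`, with proportion `α`. -/
def thresholdLinear (α : ℝ) (p d : ℕ) : ℝ :=
  2 * Real.binEntropy α * p / Real.log d

/-- Below the threshold `τ` by a constant factor, no sequence of decoders has vanishing worst-case
error for the exact support; above it by a constant factor, the normalized support error of every
version of the MLE (ties being broken arbitrarily) tends to `0` in probability, for every sequence
of binary signals. -/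
def PhaseTransitionAt {Ω : ℕ → Type*} [∀ k, MeasurableSpace (Ω k)] (P : ∀ k, Measure (Ω k))
    (n p s : ℕ → ℕ) (B N : ∀ k, Fin (n k) → Fin (p k) → Ω k → ℝ)
    (Z : ∀ k, Fin (n k) → Ω k → ℝ) (τ : ℕ → ℝ) : Prop :=
  (∀ ε : ℝ, 0 < ε → (∀ᶠ k in atTop, (n k : ℝ) ≤ (1 - ε) * τ k) →
    ¬ ∃ g : ∀ k, Decoder (n k) (p k),
      Tendsto (fun k => worstCaseError (P k) (s k) (B k) (N k) (Z k) (g k)) atTop (𝓝 0)) ∧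
  (∀ ε : ℝ, 0 < ε → (∀ᶠ k in atTop, (1 + ε) * τ k ≤ (n k : ℝ)) →
    ∀ β : ∀ k, Fin (p k) → ℝ, (∀ k, β k ∈ binarySignals (p k) (s k)) →
    ∀ βhat : ∀ k, Ω k → Fin (p k) → ℝ,
      (∀ k, ∀ᵐ ω ∂(P k), IsMLE (s k) (sparseMatrix (B k) (N k) ω)
        (observation (B k) (N k) (Z k) (β k) ω) (βhat k ω)) →
      ∀ δ : ℝ, 0 < δ →
        Tendsto (fun k => P k {ω | δ ≤ supportError (s k) (βhat k ω) (β k)}) atTop (𝓝 0))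

end SparseRecovery

end

noncomputable section

namespace SparseRecovery

open scoped NNReal ENNReal

/-! Write `x = d s / p`, `M = p.choose s`, `v = σ ^ 2`. Both directions compare `log M` with `(n /
2) log x`, so the sharp threshold is `2 log M / log x`; the two stated thresholds are asymptotically
equivalent to it (`phaseTransitionAt_of_tendsto`).

Above the threshold: a union bound over the at most `M` supports that differ from the true one in at
least `2 δ s` places. Such a competitor, with difference vector `u`, beats the truth only if `‖Z + X
u‖² ≤ ‖Z‖²`. A Chernoff bound factorizes over rows. Given the Bernoulli variables, a row of `X u` is
Gaussian with variance `K` binomial of mean at least `2 δ x`, so each row contributes about `(1 + K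
/ (4 v)) ^ (-1/2)`, that is `O(x ^ (-1/2))` on average (`modelLaw_residual_le`). The total `M (C /
√x) ^ n` vanishes, because `log C` is negligible against `log x`.

Below the threshold: a change of measure. Given `X`, the law of `Y` is `N(X β, v I)`; compare it
with `N(0, V I)`, where `V = v + x` is the variance of a coordinate of `Y` for a 0-1 signal. On the
ball `‖Y‖² ≤ n V ρ` the density ratio is at most `(V / v) ^ (n/2) exp (n ρ / 2)`, whatever `β` and
`X` are; outside it, Markov's inequality gives `1 / ρ`. Under the reference law the observation
carries no information on `β`, so the success probabilities for the `M` supports add up to at most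
1. Hence `1 ≤ error + 1 / ρ + (V / v) ^ (n/2) exp (n ρ / 2) / M` (`choose_le`), and a slowly growing
`ρ` rules out a vanishing error. -/

/-! ### Product measures and the joint law of the model. -/

theorem lintegral_pi_prod {ι : Type*} [Fintype ι] {E : ι → Type*} [∀ i, MeasurableSpace (E i)]
    (μ : ∀ i, Measure (E i)) [∀ i, IsProbabilityMeasure (μ i)] (f : ∀ i, E i → ℝ≥0∞)
    (hf : ∀ i, Measurable (f i)) :
    ∫⁻ x, ∏ i, f i (x i) ∂(Measure.pi μ) = ∏ i, ∫⁻ y, f i y ∂(μ i) := by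
  rw [lintegral_prod_eq_prod_lintegral_of_indepFun Finset.univ
    (fun i (x : ∀ i, E i) => f i (x i))
    (iIndepFun_pi fun i => (hf i).aemeasurable) (fun i => (hf i).comp (measurable_pi_apply i))]
  exact Finset.prod_congr rfl fun i _ => (measurePreserving_eval μ i).lintegral_comp (hf i)

theorem map_curry_pi {n p : ℕ} (ν : Measure ℝ) [IsProbabilityMeasure ν] :
    MeasurePreserving (fun (x : Fin n × Fin p → ℝ) i j => x (i, j))
      (Measure.pi fun _ => ν) (Measure.pi fun _ => Measure.pi fun _ => ν) := by
  have h := Measure.infinitePi_map_curry (fun (_ : Fin n) (_ : Fin p) => ν)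
  simp only [Measure.infinitePi_eq_pi] at h
  exact ⟨by fun_prop, h⟩

/-- The joint law of the Bernoulli variables, the Gaussian variables and the noise. -/
def modelLaw (n p : ℕ) (q : unitInterval) (v : ℝ≥0) :
    Measure ((Fin n → Fin p → ℝ) × (Fin n → Fin p → ℝ) × (Fin n → ℝ)) :=
  (Measure.pi fun _ => Measure.pi fun _ => bernoulliMeasure 1 0 q).prod
    ((Measure.pi fun _ => Measure.pi fun _ => gaussianReal 0 1).prod
      (Measure.pi fun _ => gaussianReal 0 v))

instance (n p : ℕ) (q : unitInterval) (v : ℝ≥0) : IsProbabilityMeasure (modelLaw n p q v) := by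
  unfold modelLaw; infer_instance

theorem IsSparseGaussianModel.hasLaw {Ω : Type*} [MeasurableSpace Ω] {P : Measure Ω} {n p : ℕ}
    {d : ℕ} {hdp : d ≤ p} {σ : ℝ} {B N : Fin n → Fin p → Ω → ℝ} {Z : Fin n → Ω → ℝ}
    (h : IsSparseGaussianModel P d hdp σ B N Z) :
    HasLaw (fun ω => ((fun i j => B i j ω), (fun i j => N i j ω), (fun i => Z i ω)))
      (modelLaw n p (densityRate d p hdp) (Real.toNNReal (σ ^ 2))) P := by
  set v : ℝ≥0 := Real.toNNReal (σ ^ 2) with hv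
  have hZ : ∀ i, HasLaw (Z i) (gaussianReal 0 v) P := by
    intro i
    have hv' : v = ⟨σ ^ 2, sq_nonneg σ⟩ := NNReal.eq (Real.coe_toNNReal _ (sq_nonneg σ))
    rw [hv']
    exact h.law_Z i
  set ν : (Fin n × Fin p) ⊕ ((Fin n × Fin p) ⊕ Fin n) → Measure ℝ :=
    Sum.elim (fun _ => bernoulliMeasure 1 0 (densityRate d p hdp))
      (Sum.elim (fun _ => gaussianReal 0 1) fun _ => gaussianReal 0 v) with hν
  have : ∀ i, IsProbabilityMeasure (ν i) := by
    rintro (i | i | i) <;> simp only [hν, Sum.elim_inl, Sum.elim_inr] <;> infer_instance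
  have hlaw := h.indep.hasLaw_pi (μ := ν) (by
    rintro (i | i | i)
    · exact h.law_B _ _
    · exact h.law_N _ _
    · exact hZ _)
  -- Independence gives a product measure over one sum type; the maps below regroup it into the
  -- three blocks and curry the matrices, so that rows become independent coordinates.
  have h1 := measurePreserving_sumPiEquivProdPi ν
  have h2 := measurePreserving_sumPiEquivProdPi (fun i => ν (.inr i))
  have h3 := (MeasurePreserving.id (Measure.pi fun i => ν (.inl i))).prod h2
  have h4 := (map_curry_pi (n := n) (p := p)
    (bernoulliMeasure (1 : ℝ) 0 (densityRate d p hdp))).prod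
    ((map_curry_pi (n := n) (p := p) (gaussianReal 0 1)).prod
      (MeasurePreserving.id (Measure.pi fun _ : Fin n => gaussianReal 0 v)))
  have h5 := h4.comp (h3.comp h1)
  refine ⟨?_, ?_⟩
  · exact h5.measurable.comp_aemeasurable hlaw.aemeasurable
  · rw [modelLaw, ← h5.map_eq, ← hlaw.map_eq,
      AEMeasurable.map_map_of_aemeasurable h5.measurable.aemeasurable hlaw.aemeasurable]
    rfl

/-! ### Gaussian and Bernoulli integrals. -/

theorem map_linear_pi_gaussianReal {p : ℕ} (a : Fin p → ℝ) :
    (Measure.pi fun _ : Fin p => gaussianReal 0 1).map (fun x => ∑ j, a j * x j)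
      = gaussianReal 0 (Real.toNNReal (∑ j, a j ^ 2)) := by
  have hm : Measurable fun x : Fin p → ℝ => ∑ j, a j * x j := by fun_prop
  have : IsProbabilityMeasure ((Measure.pi fun _ : Fin p => gaussianReal 0 1).map
      (fun x => ∑ j, a j * x j)) := Measure.isProbabilityMeasure_map hm.aemeasurable
  refine Measure.ext_of_charFun ?_
  ext t
  rw [charFun_apply_real, integral_map hm.aemeasurable (by fun_prop), charFun_gaussianReal,
    Real.coe_toNNReal _ (Finset.sum_nonneg fun j _ => sq_nonneg (a j))]
  have h : ∀ x : Fin p → ℝ, Complex.exp (t * (∑ j, a j * x j : ℝ) * Complex.I)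
      = ∏ j, Complex.exp (((t * a j : ℝ) : ℂ) * x j * Complex.I) := by
    intro x
    rw [← Complex.exp_sum]
    congr 1
    push_cast
    rw [Finset.mul_sum, Finset.sum_mul]
    exact Finset.sum_congr rfl fun j _ => by ring
  simp_rw [h]
  rw [integral_fintype_prod_eq_prod (𝕜 := ℂ)
    (fun j (y : ℝ) => Complex.exp (((t * a j : ℝ) : ℂ) * y * Complex.I))]
  simp_rw [← charFun_apply_real, charFun_gaussianReal]
  rw [← Complex.exp_sum]
  congr 1
  push_cast
  simp only [mul_zero, zero_mul, zero_sub, one_mul, Finset.sum_neg_distrib]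
  rw [← Finset.sum_div, Finset.sum_mul]
  congr 2
  exact Finset.sum_congr rfl fun j _ => by ring

theorem lintegral_exp_neg_mul_sq {b : ℝ} (hb : 0 < b) :
    ∫⁻ y : ℝ, ENNReal.ofReal (Real.exp (-b * y ^ 2)) = ENNReal.ofReal (√(Real.pi / b)) := by
  rw [← integral_gaussian, ofReal_integral_eq_lintegral_ofReal (integrable_exp_neg_mul_sq hb)
    (ae_of_all _ fun _ => (Real.exp_pos _).le)]

theorem lintegral_exp_neg_mul_sq_gaussianReal (v : ℝ≥0) {c : ℝ} (hc : 0 ≤ c) :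
    ∫⁻ y, ENNReal.ofReal (Real.exp (-(c * y ^ 2))) ∂(gaussianReal 0 v)
      = ENNReal.ofReal (√(1 + 2 * c * v))⁻¹ := by
  -- The degenerate case does occur: the conditional variance of a row is 0 when all the relevant
  -- Bernoulli variables vanish.
  rcases eq_or_ne v 0 with rfl | hv
  · simp
  have hv' : (0 : ℝ) < v := by positivity
  rw [gaussianReal_of_var_ne_zero _ hv, lintegral_withDensity_eq_lintegral_mul _
    (measurable_gaussianPDF _ _) (by fun_prop)]
  have : ∀ y : ℝ, (gaussianPDF 0 v * fun y => ENNReal.ofReal (Real.exp (-(c * y ^ 2)))) y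
      = ENNReal.ofReal (√(2 * Real.pi * v))⁻¹
        * ENNReal.ofReal (Real.exp (-((1 + 2 * c * v) / (2 * v)) * y ^ 2)) := by
    intro y
    simp only [Pi.mul_apply, gaussianPDF, gaussianPDFReal]
    rw [← ENNReal.ofReal_mul (by positivity), ← ENNReal.ofReal_mul (by positivity), mul_assoc,
      ← Real.exp_add]
    congr 3
    field_simp
    ring
  simp_rw [this]
  rw [lintegral_const_mul _ (by fun_prop), lintegral_exp_neg_mul_sq (by positivity),
    ← ENNReal.ofReal_mul (by positivity)]
  congr 1
  rw [← Real.sqrt_inv, ← Real.sqrt_inv, ← Real.sqrt_mul (by positivity)]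
  congr 1
  field_simp

theorem lintegral_exp_mul_gaussianReal (v : ℝ≥0) (t : ℝ) :
    ∫⁻ z, ENNReal.ofReal (Real.exp (t * z)) ∂(gaussianReal 0 v)
      = ENNReal.ofReal (Real.exp (v * t ^ 2 / 2)) := by
  have h := congrFun (mgf_id_gaussianReal (μ := 0) (v := v)) t
  rw [← ofReal_integral_eq_lintegral_ofReal (integrable_exp_mul_gaussianReal t)
    (ae_of_all _ fun _ => (Real.exp_pos _).le)]
  simp only [mgf, id, zero_mul, zero_add] at h
  rw [h]

theorem lintegral_add_sq_gaussianReal (v : ℝ≥0) (c : ℝ) :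
    ∫⁻ z, ENNReal.ofReal ((c + z) ^ 2) ∂(gaussianReal 0 v) = ENNReal.ofReal (c ^ 2 + v) := by
  have hm : MemLp id 2 (gaussianReal 0 v) := memLp_id_gaussianReal 2
  have hc : MemLp (fun z => c + z) 2 (gaussianReal 0 v) := (memLp_const c).add hm
  rw [← ofReal_integral_eq_lintegral_ofReal hc.integrable_sq (ae_of_all _ fun _ => sq_nonneg _)]
  congr 1
  have hv : Var[fun z => c + z; gaussianReal 0 v] = v := by
    rw [variance_const_add (by fun_prop), variance_fun_id_gaussianReal]
  rw [variance_eq_sub hc] at hv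
  have hi : ∫ z, (c + z) ∂(gaussianReal 0 v) = c := by
    have h0 : ∫ z, z ∂(gaussianReal 0 v) = 0 := integral_id_gaussianReal
    have hz : Integrable (fun z : ℝ => z) (gaussianReal 0 v) := hm.integrable (by norm_num)
    rw [integral_add (integrable_const _) hz, h0]
    simp
  rw [hi] at hv
  simp only [Pi.pow_apply] at hv
  linarith

theorem lintegral_bernoulli {q : unitInterval} (f : ℝ → ℝ≥0∞) :
    ∫⁻ b, f b ∂(bernoulliMeasure 1 0 q)
      = ENNReal.ofReal q * f 1 + ENNReal.ofReal (1 - q) * f 0 := by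
  rw [bernoulliMeasure_def]
  rw [lintegral_add_measure, lintegral_smul_measure, lintegral_smul_measure, lintegral_dirac,
    lintegral_dirac]
  have h (r : unitInterval) : ENNReal.ofReal r = (unitInterval.toNNReal r : ℝ≥0∞) := by
    rw [← unitInterval.coe_toNNReal, ENNReal.ofReal_coe_nnreal]
  rw [h, ← unitInterval.coe_symm_eq, h]
  rfl

/-- Splits according to whether `K` reaches half its mean `μ`: if so, the first term suffices by
monotonicity; if not, the second term is at least 1. The latter is the Chernoff majorant of the
event `K ≤ μ / 2`, and it factorizes when `K` is a sum of independent variables. -/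
theorem inv_sqrt_le_add_exp {c μ K : ℝ} (hc : 0 ≤ c) (hK : 0 ≤ K) (hμ : 0 ≤ μ) :
    (√(1 + 2 * c * K))⁻¹ ≤ (√(1 + c * μ))⁻¹ + Real.exp (μ / 2) * Real.exp (-K) := by
  rcases le_total (μ / 2) K with h | h
  · have h1 : (√(1 + 2 * c * K))⁻¹ ≤ (√(1 + c * μ))⁻¹ := by
      apply inv_anti₀ (by positivity)
      apply Real.sqrt_le_sqrt
      nlinarith
    have : 0 ≤ Real.exp (μ / 2) * Real.exp (-K) := by positivity
    linarith
  · have h1 : (√(1 + 2 * c * K))⁻¹ ≤ 1 := by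
      apply inv_le_one_of_one_le₀
      rw [Real.one_le_sqrt]
      have : 0 ≤ 2 * c * K := by positivity
      linarith
    have h2 : 1 ≤ Real.exp (μ / 2) * Real.exp (-K) := by
      rw [← Real.exp_add]
      exact Real.one_le_exp (by linarith)
    have : 0 ≤ (√(1 + c * μ))⁻¹ := by positivity
    linarith

theorem one_sub_add_mul_exp_neg_one_le (q : ℝ) (hq : 0 ≤ q) :
    q * Real.exp (-1) + (1 - q) ≤ Real.exp (-(3 / 5 * q)) := by
  have h := Real.add_one_le_exp (-(3 / 5 * q))
  have h1 : Real.exp (-1) ≤ 2 / 5 := by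
    rw [Real.exp_neg, inv_le_comm₀ (Real.exp_pos _) (by norm_num)]
    have := Real.exp_one_gt_d9
    norm_num
    linarith
  nlinarith

/-- Here `K = ∑ j, (b j * u j) ^ 2` is binomial with mean `μ = T.card * q`. Since `E exp (-K) ≤ exp
(-3 μ / 5)`, the lower tail costs `exp (μ / 2 - 3 μ / 5) = exp (-μ / 10)`. -/
theorem lintegral_inv_sqrt_pi_bernoulli {p : ℕ} (q : unitInterval) {c : ℝ} (hc : 0 ≤ c)
    (u : Fin p → ℝ) (T : Finset (Fin p)) (hu : ∀ j, u j ^ 2 = if j ∈ T then 1 else 0) :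
    ∫⁻ b, ENNReal.ofReal (√(1 + 2 * c * ∑ j, (b j * u j) ^ 2))⁻¹
        ∂(Measure.pi fun _ : Fin p => bernoulliMeasure 1 0 q)
      ≤ ENNReal.ofReal ((√(1 + c * (T.card * q)))⁻¹ + Real.exp (-(T.card * q / 10))) := by
  have hq0 : (0 : ℝ) ≤ q := q.2.1
  have hq1 : (q : ℝ) ≤ 1 := q.2.2
  set μ : ℝ := T.card * q with hμ
  have hμ0 : 0 ≤ μ := by positivity
  calc _ ≤ ∫⁻ b, (ENNReal.ofReal (√(1 + c * μ))⁻¹ + ENNReal.ofReal (Real.exp (μ / 2))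
          * ∏ j, ENNReal.ofReal (Real.exp (-(b j * u j) ^ 2)))
          ∂(Measure.pi fun _ : Fin p => bernoulliMeasure 1 0 q) := by
        refine lintegral_mono fun b => ?_
        rw [← ENNReal.ofReal_prod_of_nonneg (fun _ _ => (Real.exp_pos _).le),
          ← ENNReal.ofReal_mul (Real.exp_pos _).le, ← ENNReal.ofReal_add (by positivity)
            (by positivity), ← Real.exp_sum, Finset.sum_neg_distrib]
        exact ENNReal.ofReal_le_ofReal
          (inv_sqrt_le_add_exp hc (Finset.sum_nonneg fun _ _ => sq_nonneg _) hμ0)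
    _ = ENNReal.ofReal (√(1 + c * μ))⁻¹ + ENNReal.ofReal (Real.exp (μ / 2))
          * ∏ j, ∫⁻ y, ENNReal.ofReal (Real.exp (-(y * u j) ^ 2)) ∂(bernoulliMeasure 1 0 q) := by
        rw [lintegral_add_left (by fun_prop), lintegral_const_mul _ (by fun_prop),
          lintegral_pi_prod _ (fun j y => ENNReal.ofReal (Real.exp (-(y * u j) ^ 2)))
            (fun j => by fun_prop)]
        simp
    _ ≤ ENNReal.ofReal (√(1 + c * μ))⁻¹ + ENNReal.ofReal (Real.exp (μ / 2))
          * ∏ j, ENNReal.ofReal (if j ∈ T then Real.exp (-(3 / 5 * q)) else 1) := by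
        gcongr with j
        rw [lintegral_bernoulli, ← ENNReal.ofReal_mul hq0, ← ENNReal.ofReal_mul (by linarith),
          ← ENNReal.ofReal_add (by positivity)
            (mul_nonneg (by linarith) (Real.exp_pos _).le)]
        apply ENNReal.ofReal_le_ofReal
        rw [one_mul, hu, zero_mul]
        split_ifs
        · simpa using one_sub_add_mul_exp_neg_one_le q hq0
        · simp
    _ = ENNReal.ofReal ((√(1 + c * μ))⁻¹ + Real.exp (-(μ / 10))) := by
        rw [← ENNReal.ofReal_prod_of_nonneg (fun _ _ => by positivity), Finset.prod_ite_mem,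
          Finset.univ_inter, Finset.prod_const, ← Real.exp_nat_mul, ← ENNReal.ofReal_mul
            (by positivity), ← Real.exp_add, ← ENNReal.ofReal_add (by positivity) (by positivity)]
        congr 3
        rw [hμ]
        ring

/-! ### Achievability: the maximum likelihood estimator. -/

/-- The factor `1 / (4 * v)` is the optimal Chernoff parameter: it minimizes `2 λ² v w² - λ w²` over
`λ`. -/
theorem lintegral_exp_neg_noise_gain {v : ℝ≥0} (hv : v ≠ 0) (w : ℝ) :
    ∫⁻ z, ENNReal.ofReal (Real.exp (-(2 * z * w + w ^ 2) / (4 * v))) ∂(gaussianReal 0 v)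
      = ENNReal.ofReal (Real.exp (-(1 / (8 * v) * w ^ 2))) := by
  have hv' : (0 : ℝ) < v := by positivity
  have h : ∀ z : ℝ, ENNReal.ofReal (Real.exp (-(2 * z * w + w ^ 2) / (4 * v)))
      = ENNReal.ofReal (Real.exp (-(w ^ 2 / (4 * v))))
        * ENNReal.ofReal (Real.exp (-(w / (2 * v)) * z)) := by
    intro z
    rw [← ENNReal.ofReal_mul (Real.exp_pos _).le, ← Real.exp_add]
    congr 2
    field_simp
    ring
  simp_rw [h]
  rw [lintegral_const_mul _ (by fun_prop), lintegral_exp_mul_gaussianReal,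
    ← ENNReal.ofReal_mul (Real.exp_pos _).le, ← Real.exp_add]
  congr 2
  field_simp
  ring

/-- A competitor that differs from the true signal on `T` fits at least as well as the truth with
exponentially small probability. -/
theorem modelLaw_residual_le {n p : ℕ} (q : unitInterval) {v : ℝ≥0} (hv : v ≠ 0)
    (u : Fin p → ℝ) (T : Finset (Fin p)) (hu : ∀ j, u j ^ 2 = if j ∈ T then 1 else 0) :
    modelLaw n p q v {t | ∑ i, (t.2.2 i + ∑ j, t.1 i j * t.2.1 i j * u j) ^ 2 ≤ ∑ i, t.2.2 i ^ 2}
      ≤ ENNReal.ofReal ((√(1 + 1 / (8 * v) * (T.card * q)))⁻¹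
          + Real.exp (-(T.card * q / 10))) ^ n := by
  have hv' : (0 : ℝ) < v := by positivity
  -- Chernoff weight: it is at least 1 on the event and a product over rows. It is integrated over
  -- the noise, then over the Gaussian entries, then over the Bernoulli variables.
  set F : ((Fin n → Fin p → ℝ) × (Fin n → Fin p → ℝ) × (Fin n → ℝ)) → ℝ≥0∞ := fun t =>
    ∏ i, ENNReal.ofReal (Real.exp (-(2 * t.2.2 i * (∑ j, (t.1 i j * u j) * t.2.1 i j)
      + (∑ j, (t.1 i j * u j) * t.2.1 i j) ^ 2) / (4 * v))) with hF
  have hFm : Measurable F := by fun_prop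
  calc _ ≤ ∫⁻ t, F t ∂(modelLaw n p q v) := by
        have hms : MeasurableSet {t : (Fin n → Fin p → ℝ) × (Fin n → Fin p → ℝ) × (Fin n → ℝ) |
            ∑ i, (t.2.2 i + ∑ j, t.1 i j * t.2.1 i j * u j) ^ 2 ≤ ∑ i, t.2.2 i ^ 2} :=
          measurableSet_le (by fun_prop) (by fun_prop)
        rw [← lintegral_indicator_one hms]
        refine lintegral_mono fun t => Set.indicator_apply_le fun ht => ?_
        simp only [hF, Pi.one_apply]
        rw [← ENNReal.ofReal_prod_of_nonneg (fun _ _ => (Real.exp_pos _).le), ← Real.exp_sum,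
          ← ENNReal.ofReal_one]
        apply ENNReal.ofReal_le_ofReal
        apply Real.one_le_exp
        rw [← Finset.sum_div]
        apply div_nonneg _ (by positivity)
        simp only [Set.mem_ofPred_eq] at ht
        rw [Finset.sum_neg_distrib, neg_nonneg]
        have hw : ∀ i, ∑ j, (t.1 i j * u j) * t.2.1 i j = ∑ j, t.1 i j * t.2.1 i j * u j :=
          fun i => Finset.sum_congr rfl fun j _ => by ring
        simp_rw [hw]
        rw [← sub_nonpos, ← Finset.sum_sub_distrib] at ht
        refine le_trans (le_of_eq (Finset.sum_congr rfl fun i _ => ?_)) ht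
        ring
    _ = ∏ _i : Fin n, ∫⁻ b, ENNReal.ofReal (√(1 + 2 * (1 / (8 * v)) * ∑ j, (b j * u j) ^ 2))⁻¹
        ∂(Measure.pi fun _ : Fin p => bernoulliMeasure 1 0 q) := by
        rw [modelLaw, lintegral_prod _ hFm.aemeasurable]
        have h1 : ∀ b : Fin n → Fin p → ℝ, ∀ N : Fin n → Fin p → ℝ,
            ∫⁻ z, F (b, N, z) ∂(Measure.pi fun _ => gaussianReal 0 v)
            = ∏ i, ENNReal.ofReal (Real.exp (-(1 / (8 * v)
                * (∑ j, (b i j * u j) * N i j) ^ 2))) := by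
          intro b N
          simp only [hF]
          rw [lintegral_pi_prod _ (fun i z => ENNReal.ofReal (Real.exp (-(2 * z
            * (∑ j, (b i j * u j) * N i j) + (∑ j, (b i j * u j) * N i j) ^ 2) / (4 * v))))
            (fun i => by fun_prop)]
          exact Finset.prod_congr rfl fun i _ => lintegral_exp_neg_noise_gain hv _
        have h2 : ∀ b : Fin n → Fin p → ℝ, ∫⁻ y, F (b, y)
            ∂((Measure.pi fun _ => Measure.pi fun _ => gaussianReal 0 1).prod
              (Measure.pi fun _ => gaussianReal 0 v))
            = ∏ i, ENNReal.ofReal (√(1 + 2 * (1 / (8 * v)) * ∑ j, (b i j * u j) ^ 2))⁻¹ := by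
          intro b
          have hFb : Measurable fun y => F (b, y) := hFm.comp measurable_prodMk_left
          rw [lintegral_prod _ hFb.aemeasurable]
          simp_rw [h1]
          rw [lintegral_pi_prod _ (fun i (N : Fin p → ℝ) => ENNReal.ofReal (Real.exp (-(1 / (8 * v)
                * (∑ j, (b i j * u j) * N j) ^ 2)))) (fun i => by fun_prop)]
          refine Finset.prod_congr rfl fun i _ => ?_
          have hm : Measurable fun x : Fin p → ℝ => ∑ j, (b i j * u j) * x j := by fun_prop
          rw [← Real.coe_toNNReal (∑ j, (b i j * u j) ^ 2)
            (Finset.sum_nonneg fun j _ => sq_nonneg _),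
            ← lintegral_exp_neg_mul_sq_gaussianReal _ (by positivity),
            ← map_linear_pi_gaussianReal, lintegral_map (by fun_prop) hm]
        simp_rw [h2]
        rw [lintegral_pi_prod _ (fun _ (b : Fin p → ℝ) => ENNReal.ofReal
          (√(1 + 2 * (1 / (8 * v)) * ∑ j, (b j * u j) ^ 2))⁻¹) (fun i => by fun_prop)]
    _ ≤ _ := by
        rw [Finset.prod_const, Finset.card_univ, Fintype.card_fin]
        gcongr
        exact lintegral_inv_sqrt_pi_bernoulli q (by positivity) u T hu

/-- The 0-1 vector supported on `S`. -/
def indicatorVec {p : ℕ} (S : Finset (Fin p)) : Fin p → ℝ := fun j => if j ∈ S then 1 else 0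

theorem supp_indicatorVec {p : ℕ} (S : Finset (Fin p)) : supp (indicatorVec S) = S := by
  ext j
  simp [supp, indicatorVec]

theorem eq_indicatorVec_of_mem {p s : ℕ} {β : Fin p → ℝ} (hβ : β ∈ binarySignals p s) :
    β = indicatorVec (supp β) := by
  ext j
  rcases hβ.1 j with h | h <;> simp [indicatorVec, supp, h]

theorem sq_indicatorVec_sub {p : ℕ} (S T : Finset (Fin p)) (j : Fin p) :
    (indicatorVec S j - indicatorVec T j) ^ 2 = if j ∈ symmDiff T S then 1 else 0 := by
  by_cases h1 : j ∈ S <;> by_cases h2 : j ∈ T <;> simp [indicatorVec, Finset.mem_symmDiff, h1, h2]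

theorem IsMLE.sum_sq_le {n p s : ℕ} {X : Matrix (Fin n) (Fin p) ℝ} {z : Fin n → ℝ}
    {β βhat : Fin p → ℝ} (hβ : β ∈ binarySignals p s)
    (h : IsMLE s X (X.mulVec β + z) βhat) :
    ∑ i, (z i + ∑ j, X i j * (β j - βhat j)) ^ 2 ≤ ∑ i, z i ^ 2 := by
  have h1 := h.2 hβ
  simp only [Set.mem_ofPred_eq, EuclideanSpace.norm_sq_eq, Real.norm_eq_abs, sq_abs] at h1
  have h2 : ∀ i, (X.mulVec β + z - X.mulVec βhat) i = z i + ∑ j, X i j * (β j - βhat j) := by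
    intro i
    simp only [Pi.sub_apply, Pi.add_apply, Matrix.mulVec, dotProduct, mul_sub,
      Finset.sum_sub_distrib]
    ring
  simpa only [h2, add_sub_cancel_left] using h1

theorem IsSparseGaussianModel.measure_supportError_le {Ω : Type*} [MeasurableSpace Ω]
    {P : Measure Ω} {n p s : ℕ} {d : ℕ} {hdp : d ≤ p} {σ : ℝ} (hσ : 0 < σ)
    {B N : Fin n → Fin p → Ω → ℝ} {Z : Fin n → Ω → ℝ}
    (h : IsSparseGaussianModel P d hdp σ B N Z) {β : Fin p → ℝ} (hβ : β ∈ binarySignals p s)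
    {βhat : Ω → Fin p → ℝ}
    (hmle : ∀ᵐ ω ∂P, IsMLE s (sparseMatrix B N ω) (observation B N Z β ω) (βhat ω))
    {δ : ℝ} (hδ : 0 < δ) (hs : 0 < s) :
    P {ω | δ ≤ supportError s (βhat ω) β} ≤ p.choose s *
      ENNReal.ofReal ((√(1 + 1 / (8 * σ ^ 2) * (2 * δ * (d * s / p))))⁻¹
          + Real.exp (-(2 * δ * (d * s / p) / 10))) ^ n := by
  classical
  set v : ℝ≥0 := Real.toNNReal (σ ^ 2) with hv
  have hvc : (v : ℝ) = σ ^ 2 := Real.coe_toNNReal _ (sq_nonneg σ)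
  have hv0 : v ≠ 0 := by
    rw [← NNReal.coe_ne_zero, hvc]; positivity
  set 𝒮 := ((Finset.univ : Finset (Fin p)).powersetCard s).filter
    (fun S => 2 * δ * s ≤ (symmDiff S (supp β)).card) with h𝒮
  set E : Finset (Fin p) → Set ((Fin n → Fin p → ℝ) × (Fin n → Fin p → ℝ) × (Fin n → ℝ)) :=
    fun S => {t | ∑ i, (t.2.2 i + ∑ j, t.1 i j * t.2.1 i j * (indicatorVec (supp β) j
      - indicatorVec S j)) ^ 2 ≤ ∑ i, t.2.2 i ^ 2} with hE
  set f : Ω → ((Fin n → Fin p → ℝ) × (Fin n → Fin p → ℝ) × (Fin n → ℝ)) :=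
    fun ω => ((fun i j => B i j ω), (fun i j => N i j ω), (fun i => Z i ω)) with hf
  calc P {ω | δ ≤ supportError s (βhat ω) β} ≤ P (⋃ S ∈ 𝒮, f ⁻¹' (E S)) := by
        -- `βhat` need not be measurable; its error event is covered, up to a null set, by finitely
        -- many measurable events.
        apply measure_mono_ae
        filter_upwards [hmle] with ω hω hω2
        have hω2 : δ ≤ ((symmDiff (supp (βhat ω)) (supp β)).card : ℝ) / (2 * s) := hω2
        change ω ∈ ⋃ S ∈ 𝒮, f ⁻¹' (E S)
        simp only [Set.mem_iUnion]
        refine ⟨supp (βhat ω), ?_, ?_⟩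
        · rw [h𝒮, Finset.mem_filter, Finset.mem_powersetCard]
          refine ⟨⟨Finset.subset_univ _, hω.1.2⟩, ?_⟩
          rw [le_div_iff₀ (by positivity)] at hω2
          linarith
        · have := hω.sum_sq_le hβ
          simp only [hE, hf, Set.mem_preimage, Set.mem_ofPred_eq]
          rw [← eq_indicatorVec_of_mem hβ, ← eq_indicatorVec_of_mem hω.1]
          exact this
    _ ≤ ∑ S ∈ 𝒮, P (f ⁻¹' (E S)) := measure_biUnion_finset_le _ _
    _ ≤ ∑ S ∈ 𝒮, ENNReal.ofReal ((√(1 + 1 / (8 * σ ^ 2) * (2 * δ * (d * s / p))))⁻¹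
          + Real.exp (-(2 * δ * (d * s / p) / 10))) ^ n := by
        refine Finset.sum_le_sum fun S hS => ?_
        have hmS : MeasurableSet (E S) := measurableSet_le (by fun_prop) (by fun_prop)
        have h1 : P (f ⁻¹' (E S)) = modelLaw n p (densityRate d p hdp) v (E S) :=
          h.hasLaw.measure_eq hmS
        rw [h1]
        refine (modelLaw_residual_le _ hv0 _ _ (sq_indicatorVec_sub (supp β) S)).trans ?_
        have hcard : 2 * δ * (d * s / p) ≤ (symmDiff S (supp β)).card
            * ((densityRate d p hdp : unitInterval) : ℝ) := by
          have h2 := (Finset.mem_filter.mp hS).2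
          change _ ≤ _ * ((d : ℝ) / p)
          calc 2 * δ * (d * s / p) = 2 * δ * s * (d / p) := by ring
            _ ≤ _ := by gcongr
        rw [hvc]
        gcongr
    _ ≤ _ := by
        rw [Finset.sum_const, nsmul_eq_mul]
        gcongr
        refine (Finset.card_filter_le _ _).trans ?_
        rw [Finset.card_powersetCard, Finset.card_univ, Fintype.card_fin]

/-! ### Converse: change of measure to a signal-free observation. -/

/-- It is enough to check boxes, where the indicator of a box is the product of the indicators of
its sides. -/
theorem pi_withDensity {ι : Type*} [Fintype ι] {E : ι → Type*} [∀ i, MeasurableSpace (E i)]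
    (μ : ∀ i, Measure (E i)) [∀ i, IsProbabilityMeasure (μ i)] (f : ∀ i, E i → ℝ≥0∞)
    (hf : ∀ i, Measurable (f i)) [∀ i, SigmaFinite ((μ i).withDensity (f i))] :
    Measure.pi (fun i => (μ i).withDensity (f i))
      = (Measure.pi μ).withDensity fun x => ∏ i, f i (x i) := by
  refine Measure.pi_eq fun s hs => ?_
  rw [withDensity_apply _ (MeasurableSet.univ_pi hs),
    ← lintegral_indicator (MeasurableSet.univ_pi hs)]
  have h : ∀ x : ∀ i, E i, (Set.univ.pi s).indicator (fun x => ∏ i, f i (x i)) x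
      = ∏ i, (s i).indicator (f i) (x i) := by
    intro x
    by_cases hx : x ∈ Set.univ.pi s
    · rw [Set.indicator_of_mem hx]
      exact Finset.prod_congr rfl fun i _ => (Set.indicator_of_mem (hx i (Set.mem_univ i)) _).symm
    · rw [Set.indicator_of_notMem hx]
      simp only [Set.mem_pi, Set.mem_univ, true_imp_iff, not_forall] at hx
      obtain ⟨i, hi⟩ := hx
      exact (Finset.prod_eq_zero (Finset.mem_univ i) (Set.indicator_of_notMem hi _)).symm
  simp_rw [h]
  rw [lintegral_pi_prod _ (fun i => (s i).indicator (f i)) (fun i => (hf i).indicator (hs i))]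
  exact Finset.prod_congr rfl fun i _ => by
    rw [lintegral_indicator (hs i), withDensity_apply _ (hs i)]

/-- The density of `gaussianReal c v` with respect to `gaussianReal 0 V`. -/
def gaussianRatio (v V : ℝ≥0) (c y : ℝ) : ℝ≥0∞ :=
  ENNReal.ofReal (√(V / v) * Real.exp (-(y - c) ^ 2 / (2 * v) + y ^ 2 / (2 * V)))

theorem measurable_gaussianRatio (v V : ℝ≥0) (c : ℝ) : Measurable (gaussianRatio v V c) := by
  unfold gaussianRatio
  fun_prop

theorem gaussianReal_withDensity_ratio {v V : ℝ≥0} (hv : v ≠ 0) (hV : V ≠ 0) (c : ℝ) :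
    (gaussianReal 0 V).withDensity (gaussianRatio v V c) = gaussianReal c v := by
  have hv' : (0 : ℝ) < v := by positivity
  have hV' : (0 : ℝ) < V := by positivity
  rw [gaussianReal_of_var_ne_zero _ hv, gaussianReal_of_var_ne_zero _ hV,
    ← withDensity_mul _ (measurable_gaussianPDF _ _) (measurable_gaussianRatio _ _ _)]
  congr 1
  ext y
  simp only [Pi.mul_apply, gaussianPDF, gaussianPDFReal, gaussianRatio]
  rw [← ENNReal.ofReal_mul (by positivity)]
  congr 1
  rw [mul_mul_mul_comm, ← Real.exp_add]
  congr 1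
  · rw [← Real.sqrt_inv, ← Real.sqrt_inv, ← Real.sqrt_mul (by positivity)]
    congr 1
    field_simp
  · congr 1
    field_simp
    ring

/-- Dropping the square around `c` makes the bound independent of `c`, hence of the design and the
signal. -/
theorem gaussianRatio_le (v V : ℝ≥0) (c y : ℝ) :
    gaussianRatio v V c y ≤ ENNReal.ofReal (√(V / v) * Real.exp (y ^ 2 / (2 * V))) := by
  unfold gaussianRatio
  gcongr
  have : 0 ≤ (y - c) ^ 2 / (2 * (v : ℝ)) := by positivity
  rw [neg_div]
  linarith

theorem pi_gaussianReal_inter_ball_le {n : ℕ} {v V : ℝ≥0} (hv : v ≠ 0) (hV : V ≠ 0)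
    (c : Fin n → ℝ) (R : ℝ) {A : Set (Fin n → ℝ)} (hA : MeasurableSet A) :
    Measure.pi (fun i => gaussianReal (c i) v) (A ∩ {y | ∑ i, y i ^ 2 ≤ R})
      ≤ ENNReal.ofReal (√(V / v) ^ n * Real.exp (R / (2 * V)))
        * Measure.pi (fun _ : Fin n => gaussianReal 0 V) A := by
  have hball : MeasurableSet {y : Fin n → ℝ | ∑ i, y i ^ 2 ≤ R} :=
    measurableSet_le (by fun_prop) (by fun_prop)
  have hrw : Measure.pi (fun i => gaussianReal (c i) v)
      = (Measure.pi fun _ : Fin n => gaussianReal 0 V).withDensity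
        fun y => ∏ i, gaussianRatio v V (c i) (y i) := by
    have : ∀ i, SigmaFinite ((gaussianReal 0 V).withDensity (gaussianRatio v V (c i))) := by
      intro i
      rw [gaussianReal_withDensity_ratio hv hV]
      infer_instance
    rw [← pi_withDensity _ _ (fun i => measurable_gaussianRatio v V (c i))]
    simp_rw [gaussianReal_withDensity_ratio hv hV]
  rw [hrw, withDensity_apply _ (hA.inter hball)]
  calc _ ≤ ∫⁻ _ in A ∩ {y | ∑ i, y i ^ 2 ≤ R},
        ENNReal.ofReal (√(V / v) ^ n * Real.exp (R / (2 * V)))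
          ∂(Measure.pi fun _ : Fin n => gaussianReal 0 V) := by
        refine setLIntegral_mono (by fun_prop) fun y hy => ?_
        calc _ ≤ ∏ i, ENNReal.ofReal (√(V / v) * Real.exp (y i ^ 2 / (2 * V))) :=
              Finset.prod_le_prod' fun i _ => gaussianRatio_le _ _ _ _
          _ = ENNReal.ofReal (√(V / v) ^ n * Real.exp ((∑ i, y i ^ 2) / (2 * V))) := by
              rw [← ENNReal.ofReal_prod_of_nonneg (fun _ _ => by positivity),
                Finset.prod_mul_distrib, Finset.prod_const, ← Real.exp_sum, Finset.sum_div]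
              simp
          _ ≤ _ := by
              have : ∑ i, y i ^ 2 ≤ R := hy.2
              gcongr
    _ ≤ _ := by
        rw [setLIntegral_const]
        gcongr
        exact Set.inter_subset_left

/-- The observation as a function of the model variables. -/
def obs {n p : ℕ} (β : Fin p → ℝ)
    (t : (Fin n → Fin p → ℝ) × (Fin n → Fin p → ℝ) × (Fin n → ℝ)) : Fin n → ℝ :=
  fun i => ∑ j, t.1 i j * t.2.1 i j * β j + t.2.2 i

theorem measurable_obs {n p : ℕ} (β : Fin p → ℝ) : Measurable (obs (n := n) β) := by
  unfold obs
  fun_prop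

theorem lintegral_pi_eval {n : ℕ} {E : Type*} [MeasurableSpace E] (μ : Measure E)
    [IsProbabilityMeasure μ] (i : Fin n) {f : E → ℝ≥0∞} (hf : Measurable f) :
    ∫⁻ x, f (x i) ∂(Measure.pi fun _ : Fin n => μ) = ∫⁻ y, f y ∂μ :=
  (measurePreserving_eval (fun _ : Fin n => μ) i).lintegral_comp hf

/-- The second moment is computed by conditioning: the noise adds `v`, the Gaussian entries give `∑
j, (b i j * β j) ^ 2`, and the square of a Bernoulli variable has mean `q`. -/
theorem lintegral_obs_sq {n p : ℕ} (q : unitInterval) (v : ℝ≥0) (β : Fin p → ℝ) (i : Fin n) :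
    ∫⁻ t, ENNReal.ofReal (obs β t i ^ 2) ∂(modelLaw n p q v)
      = ENNReal.ofReal (v + (∑ j, β j ^ 2) * q) := by
  have hq0 : (0 : ℝ) ≤ q := q.2.1
  have hF : Measurable fun t : (Fin n → Fin p → ℝ) × (Fin n → Fin p → ℝ) × (Fin n → ℝ) =>
      ENNReal.ofReal (obs β t i ^ 2) := by
    unfold obs
    fun_prop
  rw [modelLaw, lintegral_prod _ hF.aemeasurable]
  have h2 : ∀ b : Fin n → Fin p → ℝ, ∫⁻ y, ENNReal.ofReal (obs β (b, y) i ^ 2)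
      ∂((Measure.pi fun _ => Measure.pi fun _ => gaussianReal 0 1).prod
        (Measure.pi fun _ => gaussianReal 0 v))
      = ∑ j, ENNReal.ofReal ((b i j * β j) ^ 2) + v := by
    intro b
    have hFb : Measurable fun y : (Fin n → Fin p → ℝ) × (Fin n → ℝ) =>
      ENNReal.ofReal (obs β (b, y) i ^ 2) := hF.comp measurable_prodMk_left
    rw [lintegral_prod _ hFb.aemeasurable]
    simp only [obs]
    have h1 : ∀ N : Fin n → Fin p → ℝ, ∫⁻ z, ENNReal.ofReal ((∑ j, b i j * N i j * β j + z i) ^ 2)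
        ∂(Measure.pi fun _ : Fin n => gaussianReal 0 v)
        = ENNReal.ofReal ((∑ j, (b i j * β j) * N i j) ^ 2 + v) := by
      intro N
      rw [lintegral_pi_eval (gaussianReal 0 v) i
        (f := fun z => ENNReal.ofReal ((∑ j, b i j * N i j * β j + z) ^ 2)) (by fun_prop),
        lintegral_add_sq_gaussianReal]
      congr 3
      exact Finset.sum_congr rfl fun j _ => by ring
    simp_rw [h1]
    rw [lintegral_pi_eval _ i
        (f := fun N : Fin p → ℝ => ENNReal.ofReal ((∑ j, (b i j * β j) * N j) ^ 2 + v))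
        (by fun_prop)]
    have hm : Measurable fun x : Fin p → ℝ => ∑ j, (b i j * β j) * x j := by fun_prop
    have h3 := lintegral_map (μ := Measure.pi fun _ : Fin p => gaussianReal 0 1)
      (f := fun y : ℝ => ENNReal.ofReal (y ^ 2 + v)) (by fun_prop) hm
    rw [← h3, map_linear_pi_gaussianReal]
    have h4 := lintegral_add_sq_gaussianReal (Real.toNNReal (∑ j, (b i j * β j) ^ 2)) 0
    have hsum : 0 ≤ ∑ j, (b i j * β j) ^ 2 := Finset.sum_nonneg fun j _ => sq_nonneg _
    simp only [zero_add, ne_eq, OfNat.ofNat_ne_zero, not_false_eq_true, zero_pow,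
      Real.coe_toNNReal _ hsum] at h4
    simp_rw [ENNReal.ofReal_add (sq_nonneg _) v.coe_nonneg]
    rw [lintegral_add_left (by fun_prop), h4, ENNReal.ofReal_sum_of_nonneg
      (fun j _ => sq_nonneg _)]
    simp
  simp_rw [h2]
  rw [lintegral_pi_eval _ i
        (f := fun b : Fin p → ℝ => ∑ j, ENNReal.ofReal ((b j * β j) ^ 2) + v)
        (by fun_prop), lintegral_add_left (by fun_prop), lintegral_finsetSum _ (by fun_prop)]
  have h5 : ∀ j : Fin p, ∫⁻ b : Fin p → ℝ, ENNReal.ofReal ((b j * β j) ^ 2)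
      ∂(Measure.pi fun _ : Fin p => bernoulliMeasure 1 0 q) = ENNReal.ofReal (β j ^ 2 * q) := by
    intro j
    rw [lintegral_pi_eval _ j (f := fun y => ENNReal.ofReal ((y * β j) ^ 2)) (by fun_prop),
      lintegral_bernoulli, ← ENNReal.ofReal_mul hq0]
    simp [mul_comm]
  simp_rw [h5]
  rw [← ENNReal.ofReal_sum_of_nonneg (fun j _ => by positivity), Finset.sum_mul, add_comm,
    ENNReal.ofReal_add v.coe_nonneg (Finset.sum_nonneg fun j _ => by positivity)]
  simp

theorem modelLaw_sum_obs_sq_gt_le {n p : ℕ} (q : unitInterval) {v V : ℝ≥0} (hV : V ≠ 0)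
    (β : Fin p → ℝ) (hβ : (V : ℝ) = v + (∑ j, β j ^ 2) * q) {ρ : ℝ} (hρ : 0 < ρ) :
    modelLaw n p q v {t | n * V * ρ < ∑ i, obs β t i ^ 2} ≤ ENNReal.ofReal (1 / ρ) := by
  have hV' : (0 : ℝ) < V := by positivity
  -- With no rows the Markov threshold would be 0; the event is then empty.
  rcases Nat.eq_zero_or_pos n with rfl | hn
  · simp
  have hn' : (0 : ℝ) < n := by exact_mod_cast hn
  have hobs := measurable_obs (n := n) β
  have hm : Measurable fun t => ENNReal.ofReal (∑ i, obs (n := n) β t i ^ 2) := by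
    fun_prop
  calc _ ≤ modelLaw n p q v {t | ENNReal.ofReal (n * V * ρ)
          ≤ ENNReal.ofReal (∑ i, obs β t i ^ 2)} :=
        measure_mono fun t ht => ENNReal.ofReal_le_ofReal (le_of_lt ht)
    _ ≤ (∫⁻ t, ENNReal.ofReal (∑ i, obs β t i ^ 2) ∂(modelLaw n p q v))
          / ENNReal.ofReal (n * V * ρ) :=
        meas_ge_le_lintegral_div hm.aemeasurable (by simp; positivity) ENNReal.ofReal_ne_top
    _ = ENNReal.ofReal (1 / ρ) := by
        simp_rw [ENNReal.ofReal_sum_of_nonneg (fun i _ => sq_nonneg (obs β _ i))]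
        rw [lintegral_finsetSum _ (by fun_prop)]
        simp_rw [lintegral_obs_sq, ← hβ]
        rw [Finset.sum_const, Finset.card_univ, Fintype.card_fin, nsmul_eq_mul,
          ← ENNReal.ofReal_natCast, ← ENNReal.ofReal_mul (by positivity),
          ← ENNReal.ofReal_div_of_pos (by positivity)]
        congr 1
        field_simp

/-- The sparse matrix as a function of the model variables. -/
def design {n p : ℕ} (t : (Fin n → Fin p → ℝ) × (Fin n → Fin p → ℝ) × (Fin n → ℝ)) :
    Fin n → Fin p → ℝ :=
  fun i j => t.1 i j * t.2.1 i j

theorem measurable_design {n p : ℕ} : Measurable (design (n := n) (p := p)) := by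
  unfold design
  fun_prop

theorem measurableSet_singleton_finset {p : ℕ} (S : Finset (Fin p)) :
    MeasurableSet ({S} : Set (Finset (Fin p))) := by
  have : ({S} : Set (Finset (Fin p))) = ⋂ a, {T | a ∈ T ↔ a ∈ S} := by
    ext T
    simp [Finset.ext_iff]
  rw [this]
  refine MeasurableSet.iInter fun a => ?_
  by_cases h : a ∈ S
  · simpa [h] using measurable_finset_mem a
  · simpa [h] using measurable_finset_notMem a

/-- For a fixed design the observation is Gaussian noise shifted by `X β`, so the ball estimate
applies fibrewise. On the right the decoder is fed pure noise of variance `V`, and `β` has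
disappeared. -/
theorem modelLaw_decode_inter_ball_le {n p : ℕ} (q : unitInterval) {v V : ℝ≥0} (hv : v ≠ 0)
    (hV : V ≠ 0) (g : Decoder n p) (S : Finset (Fin p)) (β : Fin p → ℝ) (R : ℝ) :
    modelLaw n p q v {t | g.toFun (design t) (obs β t) = S ∧ ∑ i, obs β t i ^ 2 ≤ R}
      ≤ ENNReal.ofReal (√(V / v) ^ n * Real.exp (R / (2 * V)))
        * modelLaw n p q V {t | g.toFun (design t) t.2.2 = S} := by
  have hobs := measurable_obs (n := n) β
  have hdes := measurable_design (n := n) (p := p)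
  have hg : ∀ {X : Type} [MeasurableSpace X] {f : X → Fin n → Fin p → ℝ} {y : X → Fin n → ℝ},
      Measurable f → Measurable y → MeasurableSet {x | g.toFun (f x) (y x) = S} := by
    intro X _ f y hf hy
    exact (g.measurable_toFun.comp (hf.prodMk hy)) (measurableSet_singleton_finset S)
  have hball : MeasurableSet {t : (Fin n → Fin p → ℝ) × (Fin n → Fin p → ℝ) × (Fin n → ℝ) |
      ∑ i, obs β t i ^ 2 ≤ R} := measurableSet_le (by fun_prop) (by fun_prop)
  have hA : MeasurableSet {t : (Fin n → Fin p → ℝ) × (Fin n → Fin p → ℝ) × (Fin n → ℝ) |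
      g.toFun (design t) (obs β t) = S ∧ ∑ i, obs β t i ^ 2 ≤ R} :=
    (hg hdes hobs).inter hball
  have hB : MeasurableSet {t : (Fin n → Fin p → ℝ) × (Fin n → Fin p → ℝ) × (Fin n → ℝ) |
      g.toFun (design t) t.2.2 = S} := hg hdes (by fun_prop)
  have hslice : ∀ V' : ℝ≥0, ∀ A : Set ((Fin n → Fin p → ℝ) × (Fin n → Fin p → ℝ) × (Fin n → ℝ)),
      MeasurableSet A → modelLaw n p q V' A
        = ∫⁻ b, ∫⁻ N, (Measure.pi fun _ : Fin n => gaussianReal 0 V') {z | (b, N, z) ∈ A}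
          ∂(Measure.pi fun _ : Fin n => Measure.pi fun _ : Fin p => gaussianReal 0 1)
          ∂(Measure.pi fun _ : Fin n => Measure.pi fun _ : Fin p => bernoulliMeasure 1 0 q) := by
    intro V' A hA
    rw [modelLaw, Measure.prod_apply hA]
    refine lintegral_congr fun b => ?_
    rw [Measure.prod_apply (measurable_prodMk_left hA)]
    rfl
  rw [hslice v _ hA, hslice V _ hB, ← lintegral_const_mul' _ _ ENNReal.ofReal_ne_top]
  refine lintegral_mono fun b => ?_
  rw [← lintegral_const_mul' _ _ ENNReal.ofReal_ne_top]
  refine lintegral_mono fun N => ?_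
  set c : Fin n → ℝ := fun i => ∑ j, b i j * N i j * β j with hc
  have hmap : (Measure.pi fun _ : Fin n => gaussianReal 0 v).map (fun z i => c i + z i)
      = Measure.pi fun i => gaussianReal (c i) v := by
    rw [Measure.pi_map_pi (f := fun i z => c i + z) (fun i => by fun_prop)]
    congr 1
    ext1 i
    rw [gaussianReal_map_const_add, zero_add]
  have hD : MeasurableSet {y : Fin n → ℝ | g.toFun (fun i j => b i j * N i j) y = S} :=
    hg measurable_const measurable_id
  refine le_trans (le_of_eq ?_) (pi_gaussianReal_inter_ball_le hv hV c R hD)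
  have hE : MeasurableSet ({y : Fin n → ℝ | g.toFun (fun i j => b i j * N i j) y = S}
      ∩ {y | ∑ i, y i ^ 2 ≤ R}) := hD.inter (measurableSet_le (by fun_prop) (by fun_prop))
  rw [← hmap]
  exact (Measure.map_apply (by fun_prop) hE).symm

theorem IsSparseGaussianModel.choose_le {Ω : Type*} [MeasurableSpace Ω]
    {P : Measure Ω} [IsProbabilityMeasure P] {n p s : ℕ} {d : ℕ} {hdp : d ≤ p} {σ : ℝ} (hσ : 0 < σ)
    {B N : Fin n → Fin p → Ω → ℝ} {Z : Fin n → Ω → ℝ}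
    (h : IsSparseGaussianModel P d hdp σ B N Z) (g : Decoder n p) {ρ : ℝ} (hρ : 0 < ρ) :
    (p.choose s : ℝ≥0∞) ≤ p.choose s * (worstCaseError P s B N Z g + ENNReal.ofReal (1 / ρ))
      + ENNReal.ofReal (√(1 + d * s / p / σ ^ 2) ^ n * Real.exp (n * ρ / 2)) := by
  classical
  set v : ℝ≥0 := Real.toNNReal (σ ^ 2) with hv
  have hvc : (v : ℝ) = σ ^ 2 := Real.coe_toNNReal _ (sq_nonneg σ)
  have hv0 : v ≠ 0 := by
    rw [← NNReal.coe_ne_zero, hvc]; positivity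
  set q := densityRate d p hdp with hq
  have hqc : (q : ℝ) = d / p := rfl
  set V : ℝ≥0 := Real.toNNReal (σ ^ 2 + d * s / p) with hVdef
  have hVc : (V : ℝ) = σ ^ 2 + d * s / p := Real.coe_toNNReal _ (by positivity)
  have hV0 : V ≠ 0 := by
    rw [← NNReal.coe_ne_zero, hVc]; positivity
  have hV' : (0 : ℝ) < V := by positivity
  set 𝒮 := (Finset.univ : Finset (Fin p)).powersetCard s with h𝒮
  have hcard : 𝒮.card = p.choose s := by
    rw [h𝒮, Finset.card_powersetCard, Finset.card_univ, Fintype.card_fin]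
  set K : ℝ≥0∞ := ENNReal.ofReal (√(1 + d * s / p / σ ^ 2) ^ n * Real.exp (n * ρ / 2)) with hK
  set f : Ω → ((Fin n → Fin p → ℝ) × (Fin n → Fin p → ℝ) × (Fin n → ℝ)) :=
    fun ω => ((fun i j => B i j ω), (fun i j => N i j ω), (fun i => Z i ω)) with hf
  have hg : ∀ (β : Fin p → ℝ) (S : Finset (Fin p)), MeasurableSet
      {t | g.toFun (design t) (obs β t) = S} := fun β S =>
    (g.measurable_toFun.comp (measurable_design.prodMk (measurable_obs β)))
      (measurableSet_singleton_finset S)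
  have hg2 : ∀ (S : Finset (Fin p)), MeasurableSet
      {t : (Fin n → Fin p → ℝ) × (Fin n → Fin p → ℝ) × (Fin n → ℝ) |
        g.toFun (design t) t.2.2 = S} := fun S =>
    (g.measurable_toFun.comp (measurable_design.prodMk (by fun_prop)))
      (measurableSet_singleton_finset S)
  have hmain : ∀ S ∈ 𝒮, (1 : ℝ≥0∞) ≤ worstCaseError P s B N Z g + ENNReal.ofReal (1 / ρ)
      + K * modelLaw n p q V {t | g.toFun (design t) t.2.2 = S} := by
    intro S hS
    have hSs : S.card = s := (Finset.mem_powersetCard.mp hS).2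
    set β := indicatorVec S with hβ
    have hsum : ∑ j, β j ^ 2 = s := by
      simp [hβ, indicatorVec, ← hSs]
    have hβmem : β ∈ signalClass p s := by
      refine ⟨by rw [hβ, supp_indicatorVec, hSs], fun i hi => ?_⟩
      rw [hβ, supp_indicatorVec] at hi
      simp [hβ, indicatorVec, hi]
    set bad := {ω | g.toFun (sparseMatrix B N ω) (observation B N Z β ω) ≠ supp β} with hbad
    have h1 : P bad ≤ worstCaseError P s B N Z g :=
      le_iSup₂ (f := fun (β : Fin p → ℝ) (_ : β ∈ signalClass p s) =>
        P {ω | g.toFun (sparseMatrix B N ω) (observation B N Z β ω) ≠ supp β}) β hβmem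
    have h2 : P (f ⁻¹' {t | g.toFun (design t) (obs β t) = S})
        = modelLaw n p q v {t | g.toFun (design t) (obs β t) = S} :=
      h.hasLaw.measure_eq (hg β S)
    have h3 : (1 : ℝ≥0∞) ≤ P bad + P (f ⁻¹' {t | g.toFun (design t) (obs β t) = S}) := by
      rw [← measure_univ (μ := P)]
      refine (measure_mono fun ω _ => ?_).trans (measure_union_le _ _)
      by_cases hω : g.toFun (sparseMatrix B N ω) (observation B N Z β ω) = supp β
      · right
        rw [hβ, supp_indicatorVec] at hω
        exact hω
      · exact Or.inl hω
    have h4 : modelLaw n p q v {t | g.toFun (design t) (obs β t) = S}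
        ≤ modelLaw n p q v {t | n * V * ρ < ∑ i, obs β t i ^ 2}
          + modelLaw n p q v {t | g.toFun (design t) (obs β t) = S
            ∧ ∑ i, obs β t i ^ 2 ≤ n * V * ρ} := by
      refine (measure_mono fun t ht => ?_).trans (measure_union_le _ _)
      rcases lt_or_ge (n * V * ρ) (∑ i, obs β t i ^ 2) with hlt | hle
      · exact Or.inl hlt
      · exact Or.inr ⟨ht, hle⟩
    have h5 := modelLaw_sum_obs_sq_gt_le (n := n) q (v := v) hV0 β
      (by rw [hVc, hvc, hsum, hqc]; ring) hρ
    have h6 := modelLaw_decode_inter_ball_le q hv0 hV0 g S β (n * V * ρ)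
    have hKeq : ENNReal.ofReal (√(V / v) ^ n * Real.exp (n * V * ρ / (2 * V))) = K := by
      have e1 : (V : ℝ) / v = 1 + d * s / p / σ ^ 2 := by
        rw [hVc, hvc]
        field_simp
      have e2 : n * V * ρ / (2 * V) = n * ρ / 2 := by field_simp
      rw [hK, e1, e2]
    rw [hKeq] at h6
    calc (1 : ℝ≥0∞) ≤ _ := h3
      _ ≤ worstCaseError P s B N Z g + (ENNReal.ofReal (1 / ρ)
          + K * modelLaw n p q V {t | g.toFun (design t) t.2.2 = S}) := by
          rw [h2]
          exact add_le_add h1 (h4.trans (add_le_add h5 h6))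
      _ = _ := by rw [add_assoc]
  calc (p.choose s : ℝ≥0∞) = ∑ _S ∈ 𝒮, (1 : ℝ≥0∞) := by simp [hcard]
    _ ≤ ∑ S ∈ 𝒮, (worstCaseError P s B N Z g + ENNReal.ofReal (1 / ρ)
      + K * modelLaw n p q V {t | g.toFun (design t) t.2.2 = S}) := Finset.sum_le_sum hmain
    _ = p.choose s * (worstCaseError P s B N Z g + ENNReal.ofReal (1 / ρ))
        + K * ∑ S ∈ 𝒮, modelLaw n p q V {t | g.toFun (design t) t.2.2 = S} := by
        rw [Finset.sum_add_distrib, Finset.sum_const, hcard, nsmul_eq_mul, Finset.mul_sum]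
    _ ≤ p.choose s * (worstCaseError P s B N Z g + ENNReal.ofReal (1 / ρ)) + K * 1 := by
        gcongr
        -- The decoder returns a single set, so these events are disjoint for distinct `S` under one
        -- common law.
        rw [← measure_biUnion_finset _ fun S _ => hg2 S]
        · exact prob_le_one
        · intro S _ T _ hST
          refine Set.disjoint_left.mpr fun t ht ht' => hST ?_
          exact (show g.toFun (design t) t.2.2 = S from ht).symm.trans ht'
    _ = _ := by rw [mul_one]

/-! ### Asymptotics of the two bounds. -/

theorem inv_sqrt_add_exp_le {c δ x : ℝ} (hc : 0 < c) (hδ : 0 < δ) (hx : 0 < x) :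
    (√(1 + c * (2 * δ * x)))⁻¹ + Real.exp (-(2 * δ * x / 10))
      ≤ ((√(c * (2 * δ)))⁻¹ + (√(2 * δ / 10))⁻¹) / √x := by
  have h1 : (√(1 + c * (2 * δ * x)))⁻¹ ≤ (√(c * (2 * δ)))⁻¹ / √x := by
    rw [div_eq_mul_inv, ← mul_inv, ← Real.sqrt_mul (by positivity)]
    apply inv_anti₀ (by positivity)
    apply Real.sqrt_le_sqrt
    linarith
  have h2 : Real.exp (-(2 * δ * x / 10)) ≤ (√(2 * δ / 10))⁻¹ / √x := by
    rw [div_eq_mul_inv (_⁻¹), ← mul_inv, ← Real.sqrt_mul (by positivity), Real.exp_neg]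
    apply inv_anti₀ (by positivity)
    -- With `y = 2 * δ * x / 10`, the crude chain `√y ≤ 1 + y ≤ exp y` is enough: only the order `x
    -- ^ (-1/2)` matters.
    have h := Real.add_one_le_exp (2 * δ * x / 10)
    refine (Real.sqrt_le_iff.mpr ⟨by positivity, ?_⟩).trans h
    have : 0 < δ * x := by positivity
    nlinarith
  rw [add_div]
  exact add_le_add h1 h2

theorem tendsto_choose_mul_pow {n M : ℕ → ℕ} {x r : ℕ → ℝ} {C η : ℝ} (hη : 0 < η) (hC : 0 < C)
    (hx : Tendsto x atTop atTop) (hM : Tendsto (fun k => Real.log (M k)) atTop atTop)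
    (hr : ∀ᶠ k in atTop, 0 ≤ r k ∧ r k ≤ C / √(x k))
    (hn : ∀ᶠ k in atTop, (1 + η) * Real.log (M k) ≤ n k / 2 * Real.log (x k)) :
    Tendsto (fun k => (M k : ℝ≥0∞) * ENNReal.ofReal (r k) ^ n k) atTop (𝓝 0) := by
  have hlog := Real.tendsto_log_atTop.comp hx
  -- Chosen so that `(1 - κ) * (1 + η) = 1 + η / 2`: absorbing the constant `C` into a power of `x`
  -- uses only half of the margin `η`.
  set κ : ℝ := η / (2 * (1 + η)) with hκ
  have hκ0 : 0 < κ := by positivity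
  have hlim : Tendsto (fun k => ENNReal.ofReal (Real.exp (-(η / 2 * Real.log (M k))))) atTop
      (𝓝 0) := by
    rw [← ENNReal.ofReal_zero]
    refine ENNReal.tendsto_ofReal (Real.tendsto_exp_atBot.comp ?_)
    exact tendsto_neg_atTop_atBot.comp (hM.const_mul_atTop (by positivity))
  refine tendsto_of_tendsto_of_tendsto_of_le_of_le' tendsto_const_nhds hlim
    (Eventually.of_forall fun _ => bot_le) ?_
  filter_upwards [hr, hn, hx.eventually_gt_atTop 1, hM.eventually_gt_atTop 0,
    hlog.eventually_ge_atTop (Real.log C / (κ / 2))] with k ⟨hr0, hrC⟩ hnk hxk hMk hCk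
  have hx0 : 0 < x k := by linarith
  have hM0 : (0 : ℝ) < M k := by
    rcases Nat.eq_zero_or_pos (M k) with h | h
    · simp [h] at hMk
    · exact_mod_cast h
  rw [← ENNReal.ofReal_natCast, ← ENNReal.ofReal_pow hr0, ← ENNReal.ofReal_mul hM0.le]
  apply ENNReal.ofReal_le_ofReal
  have hCx : C / √(x k) = Real.exp (Real.log C - Real.log (x k) / 2) := by
    rw [Real.exp_sub, Real.exp_log hC, ← Real.log_sqrt hx0.le, Real.exp_log (by positivity)]
  have hC2 : Real.log C ≤ κ / 2 * Real.log (x k) := by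
    simp only [Function.comp_apply] at hCk
    rw [div_le_iff₀ (by positivity)] at hCk
    linarith
  calc (M k : ℝ) * r k ^ n k ≤ Real.exp (Real.log (M k)) * (C / √(x k)) ^ n k := by
        rw [Real.exp_log hM0]
        gcongr
    _ = Real.exp (Real.log (M k) + n k * (Real.log C - Real.log (x k) / 2)) := by
        rw [hCx, ← Real.exp_nat_mul, Real.exp_add]
    _ ≤ _ := by
        apply Real.exp_le_exp.mpr
        have h1 : (n k : ℝ) * (Real.log C - Real.log (x k) / 2)
            ≤ n k * (κ / 2 * Real.log (x k) - Real.log (x k) / 2) := by gcongr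
        have h2 : n k * (κ / 2 * Real.log (x k) - Real.log (x k) / 2)
            = -((1 - κ) * (n k / 2 * Real.log (x k))) := by ring
        have hκ1 : 0 < 1 - κ := by
          rw [hκ, sub_pos, div_lt_one (by positivity)]
          linarith
        have h3 := mul_le_mul_of_nonneg_left hnk hκ1.le
        have h4 : (1 - κ) * ((1 + η) * Real.log (M k)) = (1 + η / 2) * Real.log (M k) := by
          rw [hκ]
          field_simp
          ring
        linarith

theorem tendsto_exp_sub_log {n M : ℕ → ℕ} {x : ℕ → ℝ} {v η : ℝ} (hv : 0 < v) (hη : 0 < η)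
    (hx : Tendsto x atTop atTop) (hM : Tendsto (fun k => Real.log (M k)) atTop atTop)
    (hn : ∀ᶠ k in atTop, n k / 2 * Real.log (x k) ≤ (1 - 4 * η) * Real.log (M k)) :
    Tendsto (fun k => ENNReal.ofReal (√(1 + x k / v) ^ n k
      * Real.exp (n k * (η * Real.log (1 + x k / v)) / 2) / M k)) atTop (𝓝 0) := by
  have hlog := Real.tendsto_log_atTop.comp hx
  have hlim : Tendsto (fun k => ENNReal.ofReal (Real.exp (-(η * Real.log (M k))))) atTop
      (𝓝 0) := by
    rw [← ENNReal.ofReal_zero]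
    refine ENNReal.tendsto_ofReal (Real.tendsto_exp_atBot.comp ?_)
    exact tendsto_neg_atTop_atBot.comp (hM.const_mul_atTop hη)
  refine tendsto_of_tendsto_of_tendsto_of_le_of_le' tendsto_const_nhds hlim
    (Eventually.of_forall fun _ => bot_le) ?_
  filter_upwards [hn, hx.eventually_gt_atTop 1, hM.eventually_gt_atTop 0,
    hlog.eventually_ge_atTop (Real.log (1 + 1 / v) / η)] with k hnk hxk hMk hvk
  have hx0 : 0 < x k := by linarith
  have hM0 : (0 : ℝ) < M k := by
    rcases Nat.eq_zero_or_pos (M k) with h | h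
    · simp [h] at hMk
    · exact_mod_cast h
  have hL0 : 0 ≤ Real.log (x k) := Real.log_nonneg hxk.le
  apply ENNReal.ofReal_le_ofReal
  have hy : 0 < 1 + x k / v := by positivity
  have hsq : √(1 + x k / v) = Real.exp (Real.log (1 + x k / v) / 2) := by
    rw [← Real.log_sqrt hy.le, Real.exp_log (by positivity)]
  have hylog : Real.log (1 + x k / v) ≤ (1 + η) * Real.log (x k) := by
    simp only [Function.comp_apply] at hvk
    rw [div_le_iff₀ hη] at hvk
    have h1 : Real.log (1 + x k / v) ≤ Real.log ((1 + 1 / v) * x k) := by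
      apply Real.log_le_log hy
      have : (1 + 1 / v) * x k = x k + x k / v := by ring
      linarith
    rw [Real.log_mul (by positivity) hx0.ne'] at h1
    linarith
  rw [hsq, ← Real.exp_nat_mul, ← Real.exp_add]
  have hMexp : (M k : ℝ) = Real.exp (Real.log (M k)) := (Real.exp_log hM0).symm
  refine (le_of_eq (congrArg _ hMexp)).trans ?_
  rw [← Real.exp_sub]
  apply Real.exp_le_exp.mpr
  have h1 : n k * (Real.log (1 + x k / v) / 2) + n k * (η * Real.log (1 + x k / v)) / 2
      = (1 + η) * (n k / 2) * Real.log (1 + x k / v) := by ring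
  have h2 : (1 + η) * (n k / 2) * Real.log (1 + x k / v)
      ≤ (1 + η) * (n k / 2) * ((1 + η) * Real.log (x k)) := by gcongr
  have h3 : (1 + η) * (n k / 2) * ((1 + η) * Real.log (x k))
      = (1 + η) ^ 2 * (n k / 2 * Real.log (x k)) := by ring
  have h4 : (1 + η) ^ 2 * (n k / 2 * Real.log (x k))
      ≤ (1 + η) ^ 2 * ((1 - 4 * η) * Real.log (M k)) := by gcongr
  -- One factor `1 + η` comes from the ball radius, the other from replacing `log (1 + x / v)` by
  -- `log x`; the margin `4 * η` pays for both.
  have h5 : (1 + η) ^ 2 * (1 - 4 * η) ≤ 1 - η := by nlinarith [sq_nonneg η, pow_pos hη 3]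
  have h6 := mul_le_mul_of_nonneg_right h5 hMk.le
  linarith

/-- The phase transition holds at every threshold equivalent to
`2 log (p.choose s) / log (d s / p)`. -/
theorem phaseTransitionAt_of_tendsto
    (σ : ℝ) (hσ : 0 < σ) (n p s d : ℕ → ℕ) (hdp : ∀ k, d k ≤ p k)
    (hs_top : Tendsto s atTop atTop)
    (hds : Tendsto (fun k => (d k : ℝ) * s k / p k) atTop atTop)
    {Ω : ℕ → Type*} [∀ k, MeasurableSpace (Ω k)]
    (P : ∀ k, Measure (Ω k)) [∀ k, IsProbabilityMeasure (P k)]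
    (B N : ∀ k, Fin (n k) → Fin (p k) → Ω k → ℝ) (Z : ∀ k, Fin (n k) → Ω k → ℝ)
    (hmodel : ∀ k, IsSparseGaussianModel (P k) (d k) (hdp k) σ (B k) (N k) (Z k))
    (τ : ℕ → ℝ)
    (hM : Tendsto (fun k => Real.log ((p k).choose (s k))) atTop atTop)
    (hτ : Tendsto (fun k => τ k * Real.log ((d k : ℝ) * s k / p k)
      / (2 * Real.log ((p k).choose (s k)))) atTop (𝓝 1)) :
    PhaseTransitionAt P n p s B N Z τ := by
  have hlog := Real.tendsto_log_atTop.comp hds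
  refine ⟨?_, ?_⟩
  · rintro ε hε hn ⟨g, hg⟩
    -- Then `1 - 4 * η = 1 - ε / 2` exceeds `1 - ε`, which leaves room for the asymptotic
    -- equivalence of `τ`.
    set η : ℝ := ε / 8 with hη
    have hη0 : 0 < η := by positivity
    have hn' : ∀ᶠ k in atTop, n k / 2 * Real.log ((d k : ℝ) * s k / p k)
        ≤ (1 - 4 * η) * Real.log ((p k).choose (s k)) := by
      have h1 := hτ.const_mul (1 - ε)
      filter_upwards [hn, h1.eventually_lt_const (u := 1 - 4 * η) (by rw [hη]; linarith),
        hM.eventually_gt_atTop 0, hlog.eventually_gt_atTop 0] with k hnk hk hMk hxk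
      simp only [Function.comp_apply] at hxk
      rw [mul_div_assoc', div_lt_iff₀ (by positivity)] at hk
      have := mul_le_mul_of_nonneg_right hnk hxk.le
      nlinarith
    have hσ2 : 0 < σ ^ 2 := by positivity
    have hK := tendsto_exp_sub_log hσ2 hη0 hds hM hn'
    have hyt : Tendsto (fun k => Real.log (1 + (d k : ℝ) * s k / p k / σ ^ 2)) atTop atTop :=
      Real.tendsto_log_atTop.comp (tendsto_atTop_add_const_left _ _ (hds.atTop_div_const hσ2))
    have hρt : Tendsto (fun k => ENNReal.ofReal
        (1 / (η * Real.log (1 + (d k : ℝ) * s k / p k / σ ^ 2)))) atTop (𝓝 0) := by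
      rw [← ENNReal.ofReal_zero]
      refine ENNReal.tendsto_ofReal ?_
      simp only [one_div]
      exact tendsto_inv_atTop_zero.comp (hyt.const_mul_atTop hη0)
    have hsum := (hg.add hρt).add hK
    simp only [add_zero] at hsum
    refine absurd (ge_of_tendsto (b := (1 : ℝ≥0∞)) hsum ?_) (by simp)
    filter_upwards [hM.eventually_gt_atTop 0, hyt.eventually_gt_atTop 0] with k hMk hyk
    have hM0 : 0 < (p k).choose (s k) := by
      rcases Nat.eq_zero_or_pos ((p k).choose (s k)) with h | h
      · simp [h] at hMk
      · exact h
    -- The choice `ρ = η log (1 + x / σ ^ 2)` tends to infinity, so the Markov term vanishes, while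
    -- `exp (n ρ / 2)` only raises the exponent `n / 2` of `1 + x / σ ^ 2` to `(1 + η) n / 2`.
    have h1 := (hmodel k).choose_le (s := s k) hσ (g k) (mul_pos hη0 hyk)
    rw [ENNReal.ofReal_div_of_pos (y := ((p k).choose (s k) : ℝ)) (by exact_mod_cast hM0),
      ENNReal.ofReal_natCast]
    have hMne : ((p k).choose (s k) : ℝ≥0∞) ≠ 0 := by exact_mod_cast hM0.ne'
    have hMtop : ((p k).choose (s k) : ℝ≥0∞) ≠ ∞ := ENNReal.natCast_ne_top _
    rw [← ENNReal.mul_le_mul_iff_right hMne hMtop, mul_one, mul_add,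
      ENNReal.mul_div_cancel hMne hMtop]
    exact h1
  · intro ε hε hn β hβ βhat hmle δ hδ
    have hn' : ∀ᶠ k in atTop, (1 + ε / 2) * Real.log ((p k).choose (s k))
        ≤ n k / 2 * Real.log ((d k : ℝ) * s k / p k) := by
      have h1 := hτ.const_mul (1 + ε)
      filter_upwards [hn, h1.eventually_const_lt (u := 1 + ε / 2) (by linarith),
        hM.eventually_gt_atTop 0, hlog.eventually_gt_atTop 0] with k hnk hk hMk hxk
      simp only [Function.comp_apply] at hxk
      rw [mul_div_assoc', lt_div_iff₀ (by positivity)] at hk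
      have := mul_le_mul_of_nonneg_right hnk hxk.le
      nlinarith
    have hc : 0 < 1 / (8 * σ ^ 2) := by positivity
    have hlim := tendsto_choose_mul_pow (n := n) (M := fun k => (p k).choose (s k))
      (x := fun k => (d k : ℝ) * s k / p k)
      (r := fun k => (√(1 + 1 / (8 * σ ^ 2) * (2 * δ * ((d k : ℝ) * s k / p k))))⁻¹
          + Real.exp (-(2 * δ * ((d k : ℝ) * s k / p k) / 10)))
      (C := (√(1 / (8 * σ ^ 2) * (2 * δ)))⁻¹ + (√(2 * δ / 10))⁻¹) (half_pos hε)
      (by positivity) hds hM (by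
        filter_upwards [hds.eventually_gt_atTop 0] with k hk
        exact ⟨by positivity, inv_sqrt_add_exp_le hc hδ hk⟩) hn'
    refine tendsto_of_tendsto_of_tendsto_of_le_of_le' tendsto_const_nhds hlim
      (Eventually.of_forall fun _ => bot_le) ?_
    filter_upwards [hs_top.eventually_gt_atTop 0] with k hk
    exact (hmodel k).measure_supportError_le hσ (hβ k) (hmle k) hδ hk

/-! ### Estimates of the logarithm of binomial coefficients. -/

theorem mul_log_div_le_log_choose {p s : ℕ} (hs : 0 < s) (hsp : s ≤ p) :
    s * Real.log (p / s) ≤ Real.log (p.choose s) := by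
  have hs' : (0 : ℝ) < s := by exact_mod_cast hs
  have hp' : (0 : ℝ) < p := by exact_mod_cast hs.trans_le hsp
  rw [← Real.log_pow]
  apply Real.log_le_log (by positivity)
  have h1 : p ^ s * s.factorial ≤ s ^ s * p.descFactorial s := by
    rw [← Nat.descFactorial_self s, Nat.descFactorial_eq_prod_range,
      Nat.descFactorial_eq_prod_range]
    have hpow : ∀ a : ℕ, a ^ s = ∏ _i ∈ Finset.range s, a := by simp
    rw [hpow p, hpow s, ← Finset.prod_mul_distrib, ← Finset.prod_mul_distrib]
    -- Factor by factor, `p * (s - i) ≤ s * (p - i)` because `s ≤ p`.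
    refine Finset.prod_le_prod' fun i hi => ?_
    have hi' := (Finset.mem_range.mp hi).le
    zify [hi', hi'.trans hsp]
    have : (s : ℤ) ≤ p := by exact_mod_cast hsp
    have : (0 : ℤ) ≤ i := by positivity
    nlinarith
  rw [Nat.descFactorial_eq_factorial_mul_choose, mul_left_comm, mul_comm (p ^ s)] at h1
  have h2 := Nat.le_of_mul_le_mul_left h1 s.factorial_pos
  rw [div_pow, div_le_iff₀ (by positivity), mul_comm]
  exact_mod_cast h2

theorem log_choose_le_mul_log_div_add {p s : ℕ} (hs : 0 < s) (hsp : s ≤ p) :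
    Real.log (p.choose s) ≤ s * Real.log (p / s) + s := by
  have hs' : (0 : ℝ) < s := by exact_mod_cast hs
  have hp' : (0 : ℝ) < p := by exact_mod_cast hs.trans_le hsp
  have hch : (0 : ℝ) < p.choose s := by exact_mod_cast Nat.choose_pos hsp
  have h1 : (p.choose s : ℝ) ≤ (p / s) ^ s * Real.exp s := by
    calc (p.choose s : ℝ) ≤ p ^ s / s.factorial := Nat.choose_le_pow_div s p
      _ = (p / s) ^ s * (s ^ s / s.factorial) := by
          rw [div_pow]
          field_simp
      _ ≤ _ := by
          gcongr
          exact Real.pow_div_factorial_le_exp _ hs'.le _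
  calc _ ≤ Real.log ((p / s) ^ s * Real.exp s) := Real.log_le_log hch h1
    _ = _ := by rw [Real.log_mul (by positivity) (by positivity), Real.log_pow, Real.log_exp]

/-- The error term in Stirling's formula, on the logarithmic scale. -/
def stirlingError (n : ℕ) : ℝ := Real.log n.factorial - (n * Real.log n - n)

theorem tendsto_stirlingError_div : Tendsto (fun n : ℕ => stirlingError n / n) atTop (𝓝 0) := by
  have h1 : Tendsto (fun n : ℕ => Real.log (Stirling.stirlingSeq n) / n) atTop (𝓝 0) :=
    (Stirling.tendsto_stirlingSeq_sqrt_pi.log (by positivity)).div_atTop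
      tendsto_natCast_atTop_atTop
  have h2 : Tendsto (fun n : ℕ => Real.log n / n) atTop (𝓝 0) :=
    (Real.isLittleO_log_id_atTop.tendsto_div_nhds_zero).comp tendsto_natCast_atTop_atTop
  have h3 : Tendsto (fun n : ℕ => Real.log 2 / n) atTop (𝓝 0) :=
    tendsto_const_nhds.div_atTop tendsto_natCast_atTop_atTop
  have h := h1.add ((h2.add h3).div_const 2)
  simp only [add_zero, zero_div] at h
  refine h.congr' ?_
  filter_upwards [eventually_gt_atTop 0] with n hn
  have hn' : (0 : ℝ) < n := by exact_mod_cast hn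
  rw [Stirling.log_stirlingSeq_formula, stirlingError, Real.log_mul (by norm_num) hn'.ne',
    Real.log_div hn'.ne' (by positivity), Real.log_exp]
  ring

/-- The linear terms of Stirling's formula cancel and the `m log m` terms form the entropy. Each
error is divided by its own argument, so that it tends to 0 separately. -/
theorem log_choose_eq {p s : ℕ} (hs : 0 < s) (hsp : s < p) :
    Real.log (p.choose s) / p = Real.binEntropy (s / p) + stirlingError p / p
      - stirlingError s / s * (s / p)
      - stirlingError (p - s) / ((p - s : ℕ) : ℝ) * (1 - s / p) := by
  have hs' : (0 : ℝ) < s := by exact_mod_cast hs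
  have hp' : (0 : ℝ) < p := by exact_mod_cast hs.trans hsp
  have hps : (0 : ℝ) < p - s := by
    rw [sub_pos]; exact_mod_cast hsp
  have hf : ∀ m : ℕ, (m.factorial : ℝ) ≠ 0 := fun m => by exact_mod_cast m.factorial_ne_zero
  have h1 : (1 : ℝ) - s / p = (p - s) / p := by field_simp
  rw [Nat.cast_choose ℝ hsp.le, Real.log_div (hf _) (mul_ne_zero (hf _) (hf _)),
    Real.log_mul (hf _) (hf _)]
  simp only [stirlingError, Real.binEntropy, Real.log_inv]
  rw [h1, Nat.cast_sub hsp.le, Real.log_div hs'.ne' hp'.ne', Real.log_div hps.ne' hp'.ne']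
  field_simp
  ring

theorem tendsto_log_choose_div {p s : ℕ → ℕ} {α : ℝ} (hα1 : α < 1)
    (hp : Tendsto p atTop atTop) (hs : Tendsto s atTop atTop)
    (hα : Tendsto (fun k => (s k : ℝ) / p k) atTop (𝓝 α)) :
    Tendsto (fun k => Real.log ((p k).choose (s k)) / p k) atTop (𝓝 (Real.binEntropy α)) := by
  have hlt : ∀ᶠ k in atTop, s k < p k := by
    filter_upwards [hα.eventually_lt_const hα1, hp.eventually_gt_atTop 0] with k hk hpk
    rw [div_lt_one (by exact_mod_cast hpk)] at hk
    exact_mod_cast hk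
  have hpr : Tendsto (fun k => (p k : ℝ)) atTop atTop := tendsto_natCast_atTop_atTop.comp hp
  have hps : Tendsto (fun k => p k - s k) atTop atTop := by
    rw [← tendsto_natCast_atTop_iff (R := ℝ)]
    have h1 : Tendsto (fun k => (1 - (s k : ℝ) / p k) * p k) atTop atTop :=
      (hα.const_sub 1).pos_mul_atTop (by linarith) hpr
    refine h1.congr' ?_
    filter_upwards [hlt, hp.eventually_gt_atTop 0] with k hk hpk
    have : (0 : ℝ) < p k := by exact_mod_cast hpk
    rw [Nat.cast_sub hk.le]
    field_simp
  have h := (((Real.binEntropy_continuous.tendsto α).comp hα).add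
    (tendsto_stirlingError_div.comp hp)).sub ((tendsto_stirlingError_div.comp hs).mul hα)
    |>.sub ((tendsto_stirlingError_div.comp hps).mul (hα.const_sub 1))
  simp only [add_zero, zero_mul, sub_zero] at h
  refine h.congr' ?_
  filter_upwards [hlt, hs.eventually_gt_atTop 0] with k hk hsk
  exact (log_choose_eq hsk hk).symm

/-! ### Equivalence of the explicit thresholds with the binomial one. -/

/-- `log (p.choose s)` lies between `s log (p / s)` and `s log (p / s) + s`, and the extra `s` is
negligible since `p / s` tends to infinity. -/
theorem tendsto_thresholdSublinear {p s d : ℕ → ℕ} (hsp : ∀ k, s k ≤ p k)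
    (hs : Tendsto s atTop atTop) (hds : Tendsto (fun k => (d k : ℝ) * s k / p k) atTop atTop)
    (hsmall : (fun k => (s k : ℝ)) =o[atTop] fun k => (p k : ℝ)) :
    Tendsto (fun k => Real.log ((p k).choose (s k))) atTop atTop ∧
    Tendsto (fun k => thresholdSublinear (p k) (s k) (d k)
      * Real.log ((d k : ℝ) * s k / p k) / (2 * Real.log ((p k).choose (s k)))) atTop (𝓝 1) := by
  have hlog := Real.tendsto_log_atTop.comp hds
  have hspos := hs.eventually_gt_atTop 0
  have hratio : Tendsto (fun k => Real.log ((p k : ℝ) / s k)) atTop atTop := by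
    have h1 : Tendsto (fun k => (s k : ℝ) / p k) atTop (𝓝[>] 0) := by
      rw [tendsto_nhdsWithin_iff]
      refine ⟨hsmall.tendsto_div_nhds_zero, ?_⟩
      filter_upwards [hspos] with k hk
      have : 0 < p k := hk.trans_le (hsp k)
      exact Set.mem_Ioi.mpr (by positivity)
    refine Real.tendsto_log_atTop.comp ((tendsto_inv_nhdsGT_zero.comp h1).congr fun k => ?_)
    simp
  have hsr : Tendsto (fun k => (s k : ℝ)) atTop atTop := tendsto_natCast_atTop_atTop.comp hs
  have hM : Tendsto (fun k => Real.log ((p k).choose (s k))) atTop atTop := by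
    refine tendsto_atTop_mono' _ ?_ (hsr.atTop_mul_atTop₀ hratio)
    filter_upwards [hspos] with k hk
    exact mul_log_div_le_log_choose hk (hsp k)
  refine ⟨hM, ?_⟩
  have hq : Tendsto (fun k => Real.log ((p k).choose (s k))
      / (s k * Real.log ((p k : ℝ) / s k))) atTop (𝓝 1) := by
    have hup : Tendsto (fun k => 1 + (Real.log ((p k : ℝ) / s k))⁻¹) atTop (𝓝 1) := by
      simpa using (tendsto_inv_atTop_zero.comp hratio).const_add 1
    refine tendsto_of_tendsto_of_tendsto_of_le_of_le' tendsto_const_nhds hup ?_ ?_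
    · filter_upwards [hspos, hratio.eventually_gt_atTop 0] with k hk hr
      rw [one_le_div (by positivity)]
      exact mul_log_div_le_log_choose hk (hsp k)
    · filter_upwards [hspos, hratio.eventually_gt_atTop 0] with k hk hr
      rw [div_le_iff₀ (by positivity)]
      refine (log_choose_le_mul_log_div_add hk (hsp k)).trans (le_of_eq ?_)
      field_simp
  have hq' := hq.inv₀ one_ne_zero
  rw [inv_one] at hq'
  refine hq'.congr' ?_
  filter_upwards [hlog.eventually_gt_atTop 0] with k hk
  simp only [Function.comp_apply] at hk
  rw [thresholdSublinear, inv_div, div_mul_cancel₀ _ hk.ne', mul_assoc,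
    mul_div_mul_left _ _ two_ne_zero]

/-- Stirling gives `log (p.choose s) ~ H(α) p`, and `log (d s / p) = log d + log (s / p)`, whose
last term converges to `log α` while `log d` diverges. -/
theorem tendsto_thresholdLinear {p s d : ℕ → ℕ} {α : ℝ} (hα0 : 0 < α) (hα1 : α < 1)
    (hp : Tendsto p atTop atTop) (hs : Tendsto s atTop atTop) (hd : Tendsto d atTop atTop)
    (hα : Tendsto (fun k => (s k : ℝ) / p k) atTop (𝓝 α)) :
    Tendsto (fun k => Real.log ((p k).choose (s k))) atTop atTop ∧
    Tendsto (fun k => thresholdLinear α (p k) (d k)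
      * Real.log ((d k : ℝ) * s k / p k) / (2 * Real.log ((p k).choose (s k)))) atTop (𝓝 1) := by
  have hH : 0 < Real.binEntropy α := Real.binEntropy_pos hα0 hα1
  have hL := tendsto_log_choose_div hα1 hp hs hα
  have hpr : Tendsto (fun k => (p k : ℝ)) atTop atTop := tendsto_natCast_atTop_atTop.comp hp
  have hdlog : Tendsto (fun k => Real.log (d k)) atTop atTop :=
    Real.tendsto_log_atTop.comp (tendsto_natCast_atTop_atTop.comp hd)
  have hM : Tendsto (fun k => Real.log ((p k).choose (s k))) atTop atTop := by
    refine (hL.pos_mul_atTop hH hpr).congr' ?_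
    filter_upwards [hp.eventually_gt_atTop 0] with k hk
    have : (0 : ℝ) < p k := by exact_mod_cast hk
    field_simp
  refine ⟨hM, ?_⟩
  have h1 : Tendsto (fun k => 1 + Real.log ((s k : ℝ) / p k) / Real.log (d k)) atTop (𝓝 1) := by
    simpa using ((hα.log hα0.ne').div_atTop hdlog).const_add 1
  have h2 := (h1.const_mul (Real.binEntropy α)).div hL hH.ne'
  rw [mul_one, div_self hH.ne'] at h2
  refine h2.congr' ?_
  filter_upwards [hp.eventually_gt_atTop 0, hs.eventually_gt_atTop 0, hd.eventually_gt_atTop 0,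
    hdlog.eventually_gt_atTop 0, hM.eventually_gt_atTop 0] with k hpk hsk hdk hdl hMk
  have hp' : (0 : ℝ) < p k := by exact_mod_cast hpk
  have hs' : (0 : ℝ) < s k := by exact_mod_cast hsk
  have hd' : (0 : ℝ) < d k := by exact_mod_cast hdk
  simp only [Pi.div_apply]
  rw [thresholdLinear, mul_div_assoc (d k : ℝ), Real.log_mul hd'.ne' (by positivity)]
  field_simp

end SparseRecovery

end

theorem corollary1
    (σ : ℝ) (hσ : 0 < σ)
    (n p s d : ℕ → ℕ)
    (hsp : ∀ k, s k ≤ p k) (hdp : ∀ k, d k ≤ p k)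
    (hp_top : Tendsto p atTop atTop) (hs_top : Tendsto s atTop atTop)
    (hd_top : Tendsto d atTop atTop)
    (hd_small : (fun k => (d k : ℝ)) =o[atTop] fun k => (p k : ℝ))
    (hds : Tendsto (fun k => (d k : ℝ) * s k / p k) atTop atTop)
    {Ω : ℕ → Type*} [∀ k, MeasurableSpace (Ω k)]
    (P : ∀ k, Measure (Ω k)) [∀ k, IsProbabilityMeasure (P k)]
    (B N : ∀ k, Fin (n k) → Fin (p k) → Ω k → ℝ) (Z : ∀ k, Fin (n k) → Ω k → ℝ)
    (hmodel : ∀ k,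
      SparseRecovery.IsSparseGaussianModel (P k) (d k) (hdp k) σ (B k) (N k) (Z k)) :
    -- sublinear sparsity
    (((fun k => (s k : ℝ)) =o[atTop] fun k => (p k : ℝ)) →
      SparseRecovery.PhaseTransitionAt P n p s B N Z
        (fun k => SparseRecovery.thresholdSublinear (p k) (s k) (d k))) ∧
    -- linear sparsity
    (∀ α : ℝ, 0 < α → α < 1 →
      Tendsto (fun k => (s k : ℝ) / p k) atTop (𝓝 α) →
      SparseRecovery.PhaseTransitionAt P n p s B N Z
        (fun k => SparseRecovery.thresholdLinear α (p k) (d k))) := by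
  refine ⟨fun hsmall => ?_, fun α hα0 hα1 hα => ?_⟩
  · obtain ⟨hM, hτ⟩ := SparseRecovery.tendsto_thresholdSublinear hsp hs_top hds hsmall
    exact SparseRecovery.phaseTransitionAt_of_tendsto σ hσ n p s d hdp hs_top hds P B N Z hmodel
      _ hM hτ
  · obtain ⟨hM, hτ⟩ := SparseRecovery.tendsto_thresholdLinear hα0 hα1 hp_top hs_top hd_top hα
    exact SparseRecovery.phaseTransitionAt_of_tendsto σ hσ n p s d hdp hs_top hds P B N Z hmodel
      _ hM hτ
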